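/- Let $V$ be a complex vector space (of test functions, e.g. $C_0^\infty(\mathcal M,\mathbb C)$ for a spacetime $\mathcal M$) with an antilinear involution $f\mapsto f^*$, and let $\Omega$ be an antisymmetric complex-bilinear form on $V$ that is real, $\Omega[f^*,g^*]=\overline{\Omega[f,g]}$. Let $\mathcal A_0$ be the free field algebra, i.e. the unital $*$-algebra generated by symbols $\phi[f]$, complex-linear in $f\in V$, with $\phi[f]^*=\phi[f^*]$ and $[\phi[f],\phi[g]]=-i\,\Omega[f,g]$. A state is a normalized positive linear functional on $\mathcal A_0$; it is pure if it is not a nontrivial convex combination of other states; it is zero-mean Gaussian if $\omega(\phi[f])=0$ for all $f$ and all its connected correlators of order $n\ge 3$ vanish. Let $\omega_1,\omega_2$ be zero-mean Gaussian states on $\mathcal A_0$. Put $\langle f|g\rangle_{\mu_j}=\tfrac12\,\omega_j(\phi[f]^*\phi[g]+\phi[g]\phi[f]^*)$, and let $\mathcal K_{\mu_1}$ be the Hilbert space obtained from $V$ by dividing out the $\mu_1$-null vectors and completing. Assume $\mu_2\prec\mu_1$, i.e. there is a constant $c$ with $\langle f|f\rangle_{\mu_2}\le c\,\langle f|f\rangle_{\mu_1}$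 for all $f\in V$. Let $R_1,Q,X_1,X_2$ be the bounded operators on $\mathcal K_{\mu_1}$ determined, for all $f,g\in V$, by $$\langle f|R_1|g\rangle_{\mu_1}=\tfrac12\Omega[f^*,g],\qquad \langle f|Q|g\rangle_{\mu_1}=\langle f|g\rangle_{\mu_2},\qquad \langle f|X_j|g\rangle_{\mu_1}=\omega_j(\phi[f]^*\phi[g]).$$ Theorem. Suppose that $\omega_1$ is pure. Then $\mathcal K_{\mu_1}$ is the orthogonal direct sum of the eigenspaces of $R_1$ for $+i$ and $-i$ (and, if $\mathcal K_{\mu_1}\neq 0$, the eigenvalues of $R_1$ are exactly $\pm i$), the operator $Q$ is invertible with bounded inverse, and the following three conditions are equivalent: 1. $\sqrt{X_2}-\sqrt{X_1}$ is Hilbert–Schmidt; 2. both diagonal blocks of $X_2-X_1$, with respect to the decomposition of $\mathcal K_{\mu_1}$ into the $\pm i$ eigenspaces of $R_1$, are trace class; 3. $Q-1$ is Hilbert–Schmidt and $Q+R_1Q^{-1}R_1$ is trace class. -/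

import Mathlib

open scoped ComplexOrder InnerProductSpace
open Complex

noncomputable section

/-! ### The free field algebra

The space of test functions is a complex vector space `V` with a complex conjugation, written
`star`: an additive involution with `star (c • f) = conj c • star f`
(for instance, compactly supported smooth complex functions on a spacetime). -/

/-- An antisymmetric bilinear form on the space of test functions which is real, i.e. compatible
with complex conjugation. -/
structure CommutatorForm (V : Type*) [AddCommGroup V] [Module ℂ V] [StarAddMonoid V] where
  /-- the underlying bilinear form -/
  form : V →ₗ[ℂ] V →ₗ[ℂ] ℂ
  antisymm : ∀ f g, form f g = -form g f
  real : ∀ f g, form (star f) (star g) = (starRingEnd ℂ) (form f g)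

namespace TensorStar

variable (V : Type*) [AddCommGroup V] [Module ℂ V]

/-- The opposite of the tensor algebra, on which scalars act through complex conjugation. -/
def ConjOp : Type _ := (TensorAlgebra ℂ V)ᵐᵒᵖ

instance : Ring (ConjOp V) := inferInstanceAs (Ring (TensorAlgebra ℂ V)ᵐᵒᵖ)

instance : Algebra ℂ (ConjOp V) :=
  RingHom.toAlgebra' ((algebraMap ℂ (TensorAlgebra ℂ V)ᵐᵒᵖ).comp (starRingEnd ℂ))
    fun c x => Algebra.commutes (A := (TensorAlgebra ℂ V)ᵐᵒᵖ) ((starRingEnd ℂ) c) x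

variable {V}
variable [StarAddMonoid V] [StarModule ℂ V]

/-- The algebra homomorphism extending `f ↦ star f`. -/
def conjHom : TensorAlgebra ℂ V →ₐ[ℂ] ConjOp V :=
  TensorAlgebra.lift ℂ
    { toFun := fun f => MulOpposite.op (TensorAlgebra.ι ℂ (star f))
      map_add' := fun f g => by
        rw [star_add, map_add]; rfl
      map_smul' := fun c f => by
        rw [star_smul, map_smul, Algebra.smul_def, Algebra.commutes]
        exact (Algebra.smul_def (A := ConjOp V) c
          (MulOpposite.op (TensorAlgebra.ι ℂ (star f)))).symm }

/-- The conjugate-linear anti-multiplicative involution of the tensor algebra that extends the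
complex conjugation of test functions:
`star (f₁ ⊗ ⋯ ⊗ fₙ) = star fₙ ⊗ ⋯ ⊗ star f₁`. -/
instance : Star (TensorAlgebra ℂ V) where
  star x := MulOpposite.unop (conjHom x)

theorem star_ι (f : V) : star (TensorAlgebra.ι ℂ f) = TensorAlgebra.ι ℂ (star f) := by
  change MulOpposite.unop (conjHom (TensorAlgebra.ι ℂ f)) = _
  rw [conjHom, TensorAlgebra.lift_ι_apply]
  rfl

theorem star_algebraMap (c : ℂ) :
    star (algebraMap ℂ (TensorAlgebra ℂ V) c) =
      algebraMap ℂ (TensorAlgebra ℂ V) ((starRingEnd ℂ) c) := by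
  change MulOpposite.unop (conjHom (algebraMap ℂ (TensorAlgebra ℂ V) c)) = _
  rw [AlgHom.commutes]
  rfl

theorem star_mul' (x y : TensorAlgebra ℂ V) : star (x * y) = star y * star x := by
  change MulOpposite.unop (conjHom (x * y)) = _
  rw [map_mul]
  rfl

theorem star_add' (x y : TensorAlgebra ℂ V) : star (x + y) = star x + star y := by
  change MulOpposite.unop (conjHom (x + y)) = _
  rw [map_add]
  rfl

instance : StarRing (TensorAlgebra ℂ V) where
  star_involutive x := by
    induction x using TensorAlgebra.induction with
    | algebraMap c => simp only [star_algebraMap, Complex.conj_conj]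
    | ι f => simp only [star_ι, star_star]
    | mul a b ha hb => rw [star_mul', star_mul', ha, hb]
    | add a b ha hb => rw [star_add', star_add', ha, hb]
  star_mul := star_mul'
  star_add := star_add'

instance : StarModule ℂ (TensorAlgebra ℂ V) where
  star_smul c x := by
    rw [Algebra.smul_def, star_mul', star_algebraMap, ← Algebra.commutes, ← Algebra.smul_def]
    rfl

end TensorStar

section Algebra

variable {V : Type*} [AddCommGroup V] [Module ℂ V] [StarAddMonoid V]

/-- The canonical commutation relation `f ⊗ g - g ⊗ f ∼ -i Ω(f, g)`. -/
inductive CommutatorForm.Rel (Ω : CommutatorForm V) :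
    TensorAlgebra ℂ V → TensorAlgebra ℂ V → Prop
  | ccr (f g : V) : CommutatorForm.Rel Ω
      (TensorAlgebra.ι ℂ f * TensorAlgebra.ι ℂ g - TensorAlgebra.ι ℂ g * TensorAlgebra.ι ℂ f)
      (algebraMap ℂ (TensorAlgebra ℂ V) (-I * Ω.form f g))

/-- The free field algebra: the algebra generated by symbols `φ[f]`, complex linear in `f`, subject
to `[φ[f], φ[g]] = -i Ω(f, g)`. -/
abbrev FreeFieldAlgebra (Ω : CommutatorForm V) : Type _ := RingQuot Ω.Rel

/-- The field `φ[f]`. -/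
def CommutatorForm.field (Ω : CommutatorForm V) : V →ₗ[ℂ] FreeFieldAlgebra Ω :=
  (RingQuot.mkAlgHom ℂ Ω.Rel).toLinearMap ∘ₗ TensorAlgebra.ι ℂ

theorem CommutatorForm.field_commutator (Ω : CommutatorForm V) (f g : V) :
    Ω.field f * Ω.field g - Ω.field g * Ω.field f =
      algebraMap ℂ (FreeFieldAlgebra Ω) (-I * Ω.form f g) := by
  have h := RingQuot.mkAlgHom_rel ℂ (CommutatorForm.Rel.ccr (Ω := Ω) f g)
  rw [map_sub, map_mul, map_mul, AlgHom.commutes] at h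
  exact h

variable [StarModule ℂ V]

theorem CommutatorForm.rel_star (Ω : CommutatorForm V) (a b : TensorAlgebra ℂ V)
    (h : Ω.Rel a b) : Ω.Rel (star a) (star b) := by
  cases h with
  | ccr f g =>
    have h := CommutatorForm.Rel.ccr (Ω := Ω) (star g) (star f)
    have e : (starRingEnd ℂ) (-I * Ω.form f g) = -I * Ω.form (star g) (star f) := by
      rw [Ω.antisymm (star g) (star f), Ω.real]
      simp
    rw [star_sub, star_mul, star_mul, TensorStar.star_ι, TensorStar.star_ι,
      TensorStar.star_algebraMap, e]
    exact h

/-- The `*`-structure of the free field algebra, `φ[f]* = φ[star f]`. -/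
instance (Ω : CommutatorForm V) : StarRing (FreeFieldAlgebra Ω) :=
  RingQuot.starRing Ω.Rel Ω.rel_star

theorem CommutatorForm.star_mk (Ω : CommutatorForm V) (a : TensorAlgebra ℂ V) :
    star (RingQuot.mkAlgHom ℂ Ω.Rel a) = RingQuot.mkAlgHom ℂ Ω.Rel (star a) := by
  rw [← AlgHom.coe_toRingHom, RingQuot.mkAlgHom_coe, RingQuot.mkRingHom_def]
  rfl

theorem CommutatorForm.star_field (Ω : CommutatorForm V) (f : V) :
    star (Ω.field f) = Ω.field (star f) := by
  change star (RingQuot.mkAlgHom ℂ Ω.Rel (TensorAlgebra.ι ℂ f)) = _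
  rw [Ω.star_mk, TensorStar.star_ι]
  rfl

instance (Ω : CommutatorForm V) : StarModule ℂ (FreeFieldAlgebra Ω) where
  star_smul c x := by
    obtain ⟨a, rfl⟩ := RingQuot.mkAlgHom_surjective ℂ Ω.Rel x
    rw [← map_smul, Ω.star_mk, star_smul, map_smul, Ω.star_mk]

end Algebra

/-! ### Semi-inner products from positive forms -/

section Forms

variable {V : Type*} [AddCommGroup V] [Module ℂ V]

/-- The semi-inner product given by a positive sesquilinear form. -/
abbrev coreOfForm (B : V →ₗ⋆[ℂ] V →ₗ[ℂ] ℂ) (hB : ∀ f, 0 ≤ B f f) :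
    PreInnerProductSpace.Core ℂ V where
  inner f g := B f g
  conj_inner_symm f g := by
    have him : ∀ x, (B x x).im = 0 := fun x => (Complex.le_def.mp (hB x)).2.symm
    have h1 := him (f + g)
    have h2 := him (f + I • g)
    simp only [map_add, LinearMap.add_apply, map_smul, LinearMap.map_smulₛₗ,
      LinearMap.smul_apply, smul_eq_mul, Complex.add_im, Complex.mul_im, Complex.add_re,
      Complex.mul_re, Complex.conj_I, Complex.I_re, Complex.I_im, Complex.neg_re, Complex.neg_im,
      him] at h1 h2
    apply Complex.ext
    · simp only [Complex.conj_re]; linarith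
    · simp only [Complex.conj_im]; linarith
  re_inner_nonneg f := (Complex.le_def.mp (hB f)).1
  add_left f g h := by simp only [map_add, LinearMap.add_apply]
  smul_left f g c := by simp only [LinearMap.map_smulₛₗ, LinearMap.smul_apply, smul_eq_mul]

theorem form_cauchy_schwarz (B : V →ₗ⋆[ℂ] V →ₗ[ℂ] ℂ) (hB : ∀ f, 0 ≤ B f f) (f g : V) :
    ‖B f g‖ ≤ √(B f f).re * √(B g g).re :=
  InnerProductSpace.Core.norm_inner_le_norm (c := coreOfForm B hB) f g

end Forms

/-! ### States -/

section States

variable {V : Type*} [AddCommGroup V] [Module ℂ V] [StarAddMonoid V] [StarModule ℂ V]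

/-- A state on the free field algebra: a normalized positive linear functional. -/
structure FieldState (Ω : CommutatorForm V) where
  /-- the underlying linear functional -/
  eval : FreeFieldAlgebra Ω →ₗ[ℂ] ℂ
  eval_one : eval 1 = 1
  nonneg : ∀ a, 0 ≤ eval (star a * a)

namespace FieldState

variable {Ω : CommutatorForm V}

/-- A state is pure if it is not a nontrivial convex combination of other states. -/
def IsPure (ω : FieldState Ω) : Prop :=
  ∀ (ω' ω'' : FieldState Ω) (p : ℝ), 0 < p → p < 1 →
    (∀ a, ω.eval a = p * ω'.eval a + (1 - p) * ω''.eval a) →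
      (∀ a, ω'.eval a = ω.eval a) ∧ (∀ a, ω''.eval a = ω.eval a)

/-- The correlation function `ω(φ[f₁] ⋯ φ[fₙ])`. -/
def correlator (ω : FieldState Ω) (l : List V) : ℂ :=
  ω.eval (l.map Ω.field).prod

/-- All `2ⁿ` ways of splitting a list into a sublist and the complementary sublist. -/
def splits {α : Type*} : List α → List (List α × List α)
  | [] => [([], [])]
  | a :: l => (splits l).flatMap fun p => [(a :: p.1, p.2), (p.1, a :: p.2)]

theorem length_of_mem_splits {α : Type*} (l : List α) :
    ∀ p ∈ splits l, p.1.length + p.2.length = l.length := by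
  induction l with
  | nil => simp [splits]
  | cons a l ih =>
    intro p hp
    simp only [splits, List.mem_flatMap, List.mem_cons, List.not_mem_nil, or_false] at hp
    obtain ⟨q, hq, rfl | rfl⟩ := hp <;> have := ih q hq <;> simp only [List.length_cons] <;> omega

/-- The connected correlators `ωᶜ(φ[f₁] ⋯ φ[fₙ])`, i.e. the coefficients of `t₁ ⋯ tₙ` in
`log ω(exp (t₁ φ[f₁]) ⋯ exp (tₙ φ[fₙ]))`. Comparing coefficients in `∂M/∂t₁ = (∂K/∂t₁) M`, where
`M = exp K`, they are determined by
`ω(φ[f₁] ⋯ φ[fₙ]) = ∑_S ωᶜ(φ[f₁] ∏_{i ∈ S} φ[fᵢ]) ω(∏_{i ∉ S} φ[fᵢ])`,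
with the sum over all `S ⊆ {2, …, n}` and the original order kept in every product. -/
def connected (ω : FieldState Ω) : List V → ℂ
  | [] => 0
  | f :: l => ω.correlator (f :: l) -
      ((splits l).attach.map fun p =>
        if h : p.1.2 = [] then 0 else connected ω (f :: p.1.1) * ω.correlator p.1.2).sum
termination_by l => l.length
decreasing_by
  have h1 := length_of_mem_splits l p.1 p.2
  have h2 : 0 < p.1.2.length := List.length_pos_of_ne_nil h
  simp only [List.length_cons]
  omega

theorem connected_cons (ω : FieldState Ω) (f : V) (l : List V) :
    ω.connected (f :: l) = ω.correlator (f :: l) -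
      ((splits l).map fun p =>
        if p.2 = [] then 0 else ω.connected (f :: p.1) * ω.correlator p.2).sum := by
  rw [connected, ← List.attach_map_val (l := splits l) (f := fun p : List V × List V =>
    if p.2 = [] then 0 else ω.connected (f :: p.1) * ω.correlator p.2)]
  rfl

/-- Zero-mean Gaussian states: the one-point functions vanish, and so do all connected
correlators of order at least three. -/
def IsZeroMeanGaussian (ω : FieldState Ω) : Prop :=
  (∀ f, ω.eval (Ω.field f) = 0) ∧ ∀ l : List V, 3 ≤ l.length → ω.connected l = 0

/-! ### The phase-space inner product and its Hilbert space -/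

/-- The two-point function `(f, g) ↦ ω(φ[f]* φ[g])`. -/
def twoPointForm (ω : FieldState Ω) : V →ₗ⋆[ℂ] V →ₗ[ℂ] ℂ :=
  LinearMap.mk₂'ₛₗ (starRingEnd ℂ) (RingHom.id ℂ)
    (fun f g => ω.eval (star (Ω.field f) * Ω.field g))
    (fun f f' g => by simp only [map_add, star_add, add_mul])
    (fun c f g => by simp only [map_smul, star_smul, smul_mul_assoc]; rfl)
    (fun f g g' => by simp only [map_add, mul_add])
    (fun c f g => by simp only [map_smul, mul_smul_comm, RingHom.id_apply])

/-- The phase-space inner product `⟨f | g⟩_μ = ½ ω(φ[f]* φ[g] + φ[g] φ[f]*)`. -/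
def muForm (ω : FieldState Ω) : V →ₗ⋆[ℂ] V →ₗ[ℂ] ℂ :=
  LinearMap.mk₂'ₛₗ (starRingEnd ℂ) (RingHom.id ℂ)
    (fun f g => (1 / 2) * ω.eval (star (Ω.field f) * Ω.field g + Ω.field g * star (Ω.field f)))
    (fun f f' g => by simp only [map_add, star_add, add_mul, mul_add]; ring)
    (fun c f g => by
      simp only [map_smul, map_add, star_smul, smul_mul_assoc, mul_smul_comm, smul_eq_mul,
        starRingEnd_apply]
      ring)
    (fun f g g' => by simp only [map_add, add_mul, mul_add]; ring)
    (fun c f g => by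
      simp only [map_smul, map_add, smul_mul_assoc, mul_smul_comm, smul_eq_mul, RingHom.id_apply]
      ring)

end FieldState

/-- The sesquilinear form `(f, g) ↦ ½ Ω(star f, g)`. -/
def CommutatorForm.halfForm (Ω : CommutatorForm V) : V →ₗ⋆[ℂ] V →ₗ[ℂ] ℂ :=
  LinearMap.mk₂'ₛₗ (starRingEnd ℂ) (RingHom.id ℂ)
    (fun f g => (1 / 2) * Ω.form (star f) g)
    (fun f f' g => by simp only [star_add, map_add, LinearMap.add_apply]; ring)
    (fun c f g => by
      simp only [star_smul, map_smul, LinearMap.smul_apply, smul_eq_mul, starRingEnd_apply]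
      ring)
    (fun f g g' => by simp only [map_add]; ring)
    (fun c f g => by simp only [map_smul, smul_eq_mul, RingHom.id_apply]; ring)

namespace FieldState

variable {Ω : CommutatorForm V}

theorem twoPoint_nonneg (ω : FieldState Ω) (f : V) : 0 ≤ ω.twoPointForm f f :=
  ω.nonneg (Ω.field f)

theorem twoPoint_eq (ω : FieldState Ω) (f g : V) :
    ω.twoPointForm f g = ω.muForm f g - I * Ω.halfForm f g := by
  have h := congrArg ω.eval (Ω.field_commutator (star f) g)
  rw [Algebra.algebraMap_eq_smul_one, map_smul, ω.eval_one, map_sub] at h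
  simp only [twoPointForm, muForm, CommutatorForm.halfForm, LinearMap.mk₂'ₛₗ_apply, map_add,
    Ω.star_field]
  simp only [smul_eq_mul] at h
  linear_combination (1 / 2) * h

theorem twoPoint_swap (ω : FieldState Ω) (f g : V) :
    ω.twoPointForm (star g) (star f) = ω.muForm f g + I * Ω.halfForm f g := by
  have h := congrArg ω.eval (Ω.field_commutator (star f) g)
  rw [Algebra.algebraMap_eq_smul_one, map_smul, ω.eval_one, map_sub] at h
  simp only [twoPointForm, muForm, CommutatorForm.halfForm, LinearMap.mk₂'ₛₗ_apply, map_add,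
    Ω.star_field, star_star]
  simp only [smul_eq_mul] at h
  linear_combination (-1 / 2) * h

theorem muForm_eq (ω : FieldState Ω) (f g : V) :
    ω.muForm f g = (1 / 2) * (ω.twoPointForm f g + ω.twoPointForm (star g) (star f)) := by
  rw [ω.twoPoint_eq, ω.twoPoint_swap]
  ring

theorem muForm_nonneg (ω : FieldState Ω) (f : V) : 0 ≤ ω.muForm f f := by
  rw [ω.muForm_eq]
  have h2 : (0 : ℂ) ≤ 1 / 2 := by
    rw [show (1 / 2 : ℂ) = ((1 / 2 : ℝ) : ℂ) by norm_num]
    exact Complex.zero_le_real.mpr (by norm_num)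
  exact mul_nonneg h2 (add_nonneg (ω.twoPoint_nonneg f) (ω.twoPoint_nonneg (star f)))

/-- The space of test functions, to be equipped with the inner product `μ` of the state. -/
@[nolint unusedArguments]
def PhaseSpace (_ω : FieldState Ω) : Type _ := V

instance (ω : FieldState Ω) : AddCommGroup ω.PhaseSpace := inferInstanceAs (AddCommGroup V)
instance (ω : FieldState Ω) : Module ℂ ω.PhaseSpace := inferInstanceAs (Module ℂ V)

/-- The identity map from test functions to the phase space. -/
def toPhaseSpace (ω : FieldState Ω) : V ≃ₗ[ℂ] ω.PhaseSpace := LinearEquiv.refl ℂ V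

/-- The semi-inner product `μ` on the phase space. -/
abbrev phaseSpaceCore (ω : FieldState Ω) : PreInnerProductSpace.Core ℂ ω.PhaseSpace where
  inner f g := ω.muForm (ω.toPhaseSpace.symm f) (ω.toPhaseSpace.symm g)
  conj_inner_symm _ _ := (coreOfForm ω.muForm ω.muForm_nonneg).conj_inner_symm _ _
  re_inner_nonneg _ := (coreOfForm ω.muForm ω.muForm_nonneg).re_inner_nonneg _
  add_left f g h := by simp only [map_add, LinearMap.add_apply]
  smul_left f g c := by
    simp only [map_smul, LinearMap.map_smulₛₗ, LinearMap.smul_apply, smul_eq_mul]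

instance (ω : FieldState Ω) : SeminormedAddCommGroup ω.PhaseSpace :=
  InnerProductSpace.Core.toSeminormedAddCommGroup (c := ω.phaseSpaceCore)

instance (ω : FieldState Ω) : InnerProductSpace ℂ ω.PhaseSpace :=
  InnerProductSpace.ofCore ω.phaseSpaceCore

/-- The Hilbert space `K_μ`: the Hausdorff completion of the space of test functions with respect to
`μ`, i.e. the completion of its quotient by the null vectors. -/
abbrev K (ω : FieldState Ω) : Type _ := UniformSpace.Completion ω.PhaseSpace

/-- The vector `|f⟩_μ` of a test function. -/
def ket (ω : FieldState Ω) : V →ₗ[ℂ] ω.K :=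
  (UniformSpace.Completion.toComplL (𝕜 := ℂ) (E := ω.PhaseSpace)).toLinearMap ∘ₗ
    ω.toPhaseSpace.toLinearMap

theorem inner_ket (ω : FieldState Ω) (f g : V) : ⟪ω.ket f, ω.ket g⟫_ℂ = ω.muForm f g :=
  UniformSpace.Completion.inner_coe (𝕜 := ℂ) (E := ω.PhaseSpace) (ω.toPhaseSpace f)
    (ω.toPhaseSpace g)

theorem norm_ket (ω : FieldState Ω) (f : V) : ‖ω.ket f‖ = √(ω.muForm f f).re := by
  rw [@norm_eq_sqrt_re_inner ℂ, ω.inner_ket]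
  rfl

theorem denseRange_ket (ω : FieldState Ω) : DenseRange ω.ket :=
  UniformSpace.Completion.denseRange_coe (α := ω.PhaseSpace)

/-- Every sesquilinear form on test functions that is bounded with respect to `μ` is implemented by
a unique bounded operator on `K_μ`. -/
theorem existsUnique_operator (ω : FieldState Ω) (B : V →ₗ⋆[ℂ] V →ₗ[ℂ] ℂ)
    (hB : ∃ C : ℝ, ∀ f g, ‖B f g‖ ≤ C * ‖ω.ket f‖ * ‖ω.ket g‖) :
    ∃! T : ω.K →L[ℂ] ω.K, ∀ f g, ⟪ω.ket f, T (ω.ket g)⟫_ℂ = B f g := by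
  obtain ⟨C₀, hC₀⟩ := hB
  obtain ⟨C, hC0, hC⟩ : ∃ C : ℝ, 0 ≤ C ∧ ∀ f g, ‖B f g‖ ≤ C * ‖ω.ket f‖ * ‖ω.ket g‖ :=
    ⟨|C₀|, abs_nonneg _, fun f g => (hC₀ f g).trans (by gcongr; exact le_abs_self C₀)⟩
  have hd := ω.denseRange_ket
  have hext : ∀ x y : ω.K, (∀ f, ⟪ω.ket f, x⟫_ℂ = ⟪ω.ket f, y⟫_ℂ) → x = y := fun x y h =>
    hd.eq_of_inner_right ℂ h
  -- by the Riesz representation theorem, `B f g = ⟪ket f, t g⟫` for some vector `t g`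
  have hex : ∀ g, ∃ x : ω.K, (∀ f, ⟪ω.ket f, x⟫_ℂ = B f g) ∧ ‖x‖ ≤ C * ‖ω.ket g‖ := by
    intro g
    let φ : V →ₗ[ℂ] ℂ :=
      { toFun := fun f => (starRingEnd ℂ) (B f g)
        map_add' := fun f f' => by rw [map_add, LinearMap.add_apply, map_add]
        map_smul' := fun c f => by
          rw [LinearMap.map_smulₛₗ, LinearMap.smul_apply, smul_eq_mul, map_mul,
            Complex.conj_conj, RingHom.id_apply, smul_eq_mul] }
    have hφ : ∀ f, ‖φ f‖ ≤ C * ‖ω.ket g‖ * ‖ω.ket f‖ := fun f => by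
      have h1 : ‖φ f‖ = ‖B f g‖ := RCLike.norm_conj (B f g)
      rw [h1]
      linarith [hC f g]
    refine ⟨(InnerProductSpace.toDual ℂ ω.K).symm (φ.extendOfNorm ω.ket), fun f => ?_, ?_⟩
    · rw [← inner_conj_symm, InnerProductSpace.toDual_symm_apply,
        LinearMap.extendOfNorm_eq hd ⟨_, hφ⟩]
      exact Complex.conj_conj (B f g)
    · rw [LinearIsometryEquiv.norm_map]
      exact LinearMap.opNorm_extendOfNorm_le hd (by positivity) hφ
  choose t ht htn using hex
  let Ψ : V →ₗ[ℂ] ω.K :=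
    { toFun := t
      map_add' := fun g g' => hext _ _ fun f => by rw [inner_add_right, ht, ht, ht, map_add]
      map_smul' := fun c g => hext _ _ fun f => by
        rw [inner_smul_right, ht, ht, map_smul, smul_eq_mul, RingHom.id_apply] }
  have hΨ : ∀ g, Ψ.extendOfNorm ω.ket (ω.ket g) = t g := fun g =>
    LinearMap.extendOfNorm_eq (f := Ψ) hd ⟨C, htn⟩ g
  refine ⟨Ψ.extendOfNorm ω.ket, fun f g => ?_, fun T hT => ?_⟩
  · rw [hΨ, ht]
  · refine DFunLike.coe_injective (hd.equalizer T.continuous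
      (ContinuousLinearMap.continuous _) (funext fun g => hext _ _ fun f => ?_))
    simp only [Function.comp_apply]
    rw [hT, hΨ, ht]

/-- The bounded operator `T` on `K_μ` with `⟨f | T | g⟩_μ = B(f, g)`. -/
def operator (ω : FieldState Ω) (B : V →ₗ⋆[ℂ] V →ₗ[ℂ] ℂ)
    (hB : ∃ C : ℝ, ∀ f g, ‖B f g‖ ≤ C * ‖ω.ket f‖ * ‖ω.ket g‖) : ω.K →L[ℂ] ω.K :=
  (ω.existsUnique_operator B hB).choose

theorem inner_operator (ω : FieldState Ω) (B : V →ₗ⋆[ℂ] V →ₗ[ℂ] ℂ)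
    (hB : ∃ C : ℝ, ∀ f g, ‖B f g‖ ≤ C * ‖ω.ket f‖ * ‖ω.ket g‖) (f g : V) :
    ⟪ω.ket f, ω.operator B hB (ω.ket g)⟫_ℂ = B f g :=
  (ω.existsUnique_operator B hB).choose_spec.1 f g

/-- The relation `μ₂ ≺ μ₁`: there is a constant `c` with `⟨f | f⟩_{μ₂} ≤ c ⟨f | f⟩_{μ₁}` for all
test functions `f`. -/
def MuDominated (ω₂ ω₁ : FieldState Ω) : Prop :=
  ∃ c : ℝ, ∀ f, (ω₂.muForm f f).re ≤ c * (ω₁.muForm f f).re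

theorem MuDominated.refl (ω : FieldState Ω) : MuDominated ω ω := ⟨1, fun f => by rw [one_mul]⟩

theorem MuDominated.norm_le {ω₂ ω₁ : FieldState Ω} (h : MuDominated ω₂ ω₁) :
    ∃ C : ℝ, 0 ≤ C ∧ ∀ f, ‖ω₂.ket f‖ ≤ C * ‖ω₁.ket f‖ := by
  obtain ⟨c, hc⟩ := h
  refine ⟨√|c|, Real.sqrt_nonneg _, fun f => ?_⟩
  have h0 : 0 ≤ (ω₁.muForm f f).re := (Complex.le_def.mp (ω₁.muForm_nonneg f)).1
  rw [norm_ket, norm_ket, ← Real.sqrt_mul (abs_nonneg c)]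
  exact Real.sqrt_le_sqrt ((hc f).trans (mul_le_mul_of_nonneg_right (le_abs_self c) h0))

theorem norm_muForm_le (ω : FieldState Ω) (f g : V) :
    ‖ω.muForm f g‖ ≤ ‖ω.ket f‖ * ‖ω.ket g‖ := by
  rw [norm_ket, norm_ket]
  exact form_cauchy_schwarz ω.muForm ω.muForm_nonneg f g

theorem norm_twoPointForm_le (ω : FieldState Ω) (f g : V) :
    ‖ω.twoPointForm f g‖ ≤ 2 * (‖ω.ket f‖ * ‖ω.ket g‖) := by
  have key : ∀ f, √(ω.twoPointForm f f).re ≤ √2 * ‖ω.ket f‖ := by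
    intro f
    rw [norm_ket, ← Real.sqrt_mul (by norm_num)]
    apply Real.sqrt_le_sqrt
    have h1 := (Complex.le_def.mp (ω.twoPoint_nonneg (star f))).1
    have h2 := congrArg Complex.re (ω.muForm_eq f f)
    rw [show (1 / 2 : ℂ) = ((1 / 2 : ℝ) : ℂ) by norm_num, Complex.re_ofReal_mul,
      Complex.add_re] at h2
    simp only [Complex.zero_re] at h1
    linarith
  calc ‖ω.twoPointForm f g‖
      ≤ √(ω.twoPointForm f f).re * √(ω.twoPointForm g g).re :=
        form_cauchy_schwarz ω.twoPointForm ω.twoPoint_nonneg f g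
    _ ≤ (√2 * ‖ω.ket f‖) * (√2 * ‖ω.ket g‖) :=
        mul_le_mul (key f) (key g) (Real.sqrt_nonneg _) (by positivity)
    _ = (√2 * √2) * (‖ω.ket f‖ * ‖ω.ket g‖) := by ring
    _ = 2 * (‖ω.ket f‖ * ‖ω.ket g‖) := by rw [Real.mul_self_sqrt (by norm_num)]

theorem norm_halfForm_le (ω : FieldState Ω) (f g : V) :
    ‖Ω.halfForm f g‖ ≤ 3 * (‖ω.ket f‖ * ‖ω.ket g‖) := by
  have h : I * Ω.halfForm f g = ω.muForm f g - ω.twoPointForm f g := by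
    rw [ω.twoPoint_eq]; ring
  have h' : ‖Ω.halfForm f g‖ = ‖ω.muForm f g - ω.twoPointForm f g‖ := by
    rw [← h, norm_mul, Complex.norm_I, one_mul]
  rw [h']
  linarith [norm_sub_le (ω.muForm f g) (ω.twoPointForm f g), ω.norm_muForm_le f g,
    ω.norm_twoPointForm_le f g]

theorem halfForm_bounded (ω : FieldState Ω) :
    ∃ C : ℝ, ∀ f g, ‖Ω.halfForm f g‖ ≤ C * ‖ω.ket f‖ * ‖ω.ket g‖ :=
  ⟨3, fun f g => by rw [mul_assoc]; exact ω.norm_halfForm_le f g⟩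

theorem MuDominated.muForm_bounded {ω₂ ω₁ : FieldState Ω} (h : MuDominated ω₂ ω₁) :
    ∃ C : ℝ, ∀ f g, ‖ω₂.muForm f g‖ ≤ C * ‖ω₁.ket f‖ * ‖ω₁.ket g‖ := by
  obtain ⟨C, hC, hle⟩ := h.norm_le
  refine ⟨C * C, fun f g => (ω₂.norm_muForm_le f g).trans ?_⟩
  calc ‖ω₂.ket f‖ * ‖ω₂.ket g‖ ≤ (C * ‖ω₁.ket f‖) * (C * ‖ω₁.ket g‖) :=
        mul_le_mul (hle f) (hle g) (norm_nonneg _) (by positivity)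
    _ = C * C * ‖ω₁.ket f‖ * ‖ω₁.ket g‖ := by ring

theorem MuDominated.twoPointForm_bounded {ω₂ ω₁ : FieldState Ω} (h : MuDominated ω₂ ω₁) :
    ∃ C : ℝ, ∀ f g, ‖ω₂.twoPointForm f g‖ ≤ C * ‖ω₁.ket f‖ * ‖ω₁.ket g‖ := by
  obtain ⟨C, hC, hle⟩ := h.norm_le
  refine ⟨2 * (C * C), fun f g => (ω₂.norm_twoPointForm_le f g).trans ?_⟩
  calc 2 * (‖ω₂.ket f‖ * ‖ω₂.ket g‖) ≤ 2 * ((C * ‖ω₁.ket f‖) * (C * ‖ω₁.ket g‖)) := by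
        gcongr
        · exact hle f
        · exact hle g
    _ = 2 * (C * C) * ‖ω₁.ket f‖ * ‖ω₁.ket g‖ := by ring

/-- The operator `R` on `K_μ` that implements the commutator: `⟨f | R | g⟩_μ = ½ Ω(star f, g)`. -/
def R (ω : FieldState Ω) : ω.K →L[ℂ] ω.K :=
  ω.operator Ω.halfForm ω.halfForm_bounded

/-- The operator `Q` on `K_{μ₁}` that implements the inner product `μ₂`:
`⟨f | Q | g⟩_{μ₁} = ⟨f | g⟩_{μ₂}`. -/
def Q {ω₂ ω₁ : FieldState Ω} (h : MuDominated ω₂ ω₁) : ω₁.K →L[ℂ] ω₁.K :=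
  ω₁.operator ω₂.muForm h.muForm_bounded

/-- The operator `X` on `K_{μ₁}` that implements the two-point function of `ω₂`:
`⟨f | X | g⟩_{μ₁} = ω₂(φ[f]* φ[g])`. -/
def X {ω₂ ω₁ : FieldState Ω} (h : MuDominated ω₂ ω₁) : ω₁.K →L[ℂ] ω₁.K :=
  ω₁.operator ω₂.twoPointForm h.twoPointForm_bounded

theorem X_nonneg {ω₂ ω₁ : FieldState Ω} (h : MuDominated ω₂ ω₁) : 0 ≤ X h := by
  rw [ContinuousLinearMap.nonneg_iff_isPositive, ContinuousLinearMap.isPositive_iff_complex]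
  have key : ∀ x : ω₁.K, 0 ≤ ⟪x, X h x⟫_ℂ := by
    intro x
    refine isClosed_property ω₁.denseRange_ket (p := fun x => 0 ≤ ⟪x, X h x⟫_ℂ)
      (isClosed_le continuous_const (by fun_prop)) (fun f => ?_) x
    have e : ⟪ω₁.ket f, X h (ω₁.ket f)⟫_ℂ = ω₂.twoPointForm f f :=
      ω₁.inner_operator _ h.twoPointForm_bounded f f
    rw [e]
    exact ω₂.twoPoint_nonneg f
  intro x
  have hx := Complex.le_def.mp (key x)
  have hs : ⟪X h x, x⟫_ℂ = ⟪x, X h x⟫_ℂ := by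
    rw [← inner_conj_symm, Complex.conj_eq_iff_im.mpr hx.2.symm]
  rw [hs]
  exact ⟨Complex.ext rfl hx.2, hx.1⟩

end FieldState

end States

/-! ### Operator ideals and blocks -/

section Operators

variable {H : Type*} [NormedAddCommGroup H] [InnerProductSpace ℂ H] [CompleteSpace H]

/-- `T` is Hilbert–Schmidt: `tr (T† T) = ∑ ‖T eᵢ‖²` is finite for an orthonormal basis. -/
def IsHilbertSchmidt (T : H →L[ℂ] H) : Prop :=
  ∃ (w : Set H) (e : HilbertBasis w ℂ H), Summable fun i => ‖T (e i)‖ ^ 2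

/-- `T` is trace class: `tr |T| = ∑ ⟨eᵢ, |T| eᵢ⟩` is finite for an orthonormal basis, where
`|T| = (T† T)^{1/2}`. -/
def IsTraceClass (T : H →L[ℂ] H) : Prop :=
  ∃ (w : Set H) (e : HilbertBasis w ℂ H), Summable fun i => (⟪e i, CFC.abs T (e i)⟫_ℂ).re

/-- The eigenspace `{x | T x = z x}`. -/
abbrev eigenspaceOf (T : H →L[ℂ] H) (z : ℂ) : Submodule ℂ H :=
  (T - z • ContinuousLinearMap.id ℂ H).ker

/-- The diagonal block of `D` for a closed subspace `E`: the restriction of `D` to `E` followed by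
the orthogonal projection onto `E`. -/
def diagonalBlock (D : H →L[ℂ] H) (E : Submodule ℂ H) [E.HasOrthogonalProjection] : E →L[ℂ] E :=
  E.orthogonalProjectionOnto ∘L D ∘L E.subtypeL

end Operators

end

set_option linter.unusedSectionVars false

/-! ### Hilbert–Schmidt and positive trace class operators -/


section OperatorIdeals

open scoped ENNReal

variable {H : Type*} [NormedAddCommGroup H] [InnerProductSpace ℂ H] [CompleteSpace H]

/-! Put `A = -i R₁` and `P = (1 + A) / 2`. The argument has two independent halves: purity forces
`R₁² = -1`, so that `P` is the orthogonal projection onto the `+i` eigenspace; after that only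
operator theory remains.

Purity (`IsPure.R_mul_R`). Suppose `N = 1 + R₁² ≠ 0`. Since `N = (1 - i R₁)(1 + i R₁)`, a small
multiple `u` of `N |w⟩`, with `w` a real test function, is a real vector with `|u⟩⟨u| ≤ X₁`. The
two-point function is then a positive one plus `conj (ψ f) * ψ g` with `ψ = ⟨u, ·⟩` real. Hence `ω₁`
is the law of `φ_B[f] + x ψ(f)`, where `φ_B` is a Gaussian field and `x` an independent standard
normal variable. Conditioning on `x > 0` and on `x < 0` writes `ω₁` as an equal mixture of two
states with different one-point functions (`IsZeroMeanGaussian.not_isPure`). These states are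
realized on polynomials in creation variables and one extra variable for `x`. They are compared with
`ω₁` through Wick's recursion, and their positivity at fixed `x` is checked in a Bargmann space with
finitely many modes (`IsWick.nonneg`).

Operators. Now `X₁ = 2P` and `X₂ = Q + A`, and both `Q + A` and `Q - A` are nonnegative, the second
because of the `*`-operation on test functions. Cauchy–Schwarz for these forms shows that `Q` is
invertible (`isUnit_of_dominates`) and that `A Q⁻¹ A ≤ Q` (`conj_inverse_le`). With `D = Q - 1`, the
diagonal blocks of `X₂ - X₁ = D` are compressions of `Q ∓ A`, hence nonnegative. Conditions 2 and 3
are linked by the identity `(Q - A Q⁻¹ A) + A D Q⁻¹ D A = 2 (P D P + (1 - P) D (1 - P))` between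
nonnegative operators (`isTraceClass_compressions_iff`). Conditions 1 and 2 are linked by
multiplying `√X₂ - √2 P` by `1 - P` in one direction, and by factoring a difference of squares on
the range of `P` in the other (`isHilbertSchmidt_sqrt_sub_sqrt_iff`). Every operator tested for
trace class is nonnegative, so the trace class condition is always the Hilbert–Schmidt condition on
a square root. -/

theorem HilbertBasis.hasSum_norm_inner_sq {ι : Type*} (e : HilbertBasis ι ℂ H) (x : H) :
    HasSum (fun i => ‖⟪e i, x⟫_ℂ‖ ^ 2) (‖x‖ ^ 2) := by
  have h := (e.hasSum_inner_mul_inner x x).mapL Complex.reCLM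
  have e1 : Complex.reCLM ⟪x, x⟫_ℂ = ‖x‖ ^ 2 := by
    rw [Complex.reCLM_apply, inner_self_eq_norm_sq_to_K]
    norm_cast
  rw [e1] at h
  refine h.congr_fun fun i => ?_
  rw [Complex.reCLM_apply, ← inner_conj_symm x (e i), ← Complex.normSq_eq_conj_mul_self,
    Complex.ofReal_re, Complex.normSq_eq_norm_sq]

theorem HilbertBasis.tsum_enorm_inner_sq {ι : Type*} (e : HilbertBasis ι ℂ H) (x : H) :
    ∑' i, ENNReal.ofReal (‖⟪e i, x⟫_ℂ‖ ^ 2) = ENNReal.ofReal (‖x‖ ^ 2) := by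
  rw [← (e.hasSum_norm_inner_sq x).tsum_eq,
    ENNReal.ofReal_tsum_of_nonneg (fun _ => by positivity) (e.hasSum_norm_inner_sq x).summable]

/-- Both sides are the double sum of `|⟨f j, T (e i)⟩|²`, taken in the two possible orders. -/
theorem tsum_norm_sq_adjoint {ι κ : Type*} (e : HilbertBasis ι ℂ H) (f : HilbertBasis κ ℂ H)
    (T : H →L[ℂ] H) :
    ∑' i, ENNReal.ofReal (‖T (e i)‖ ^ 2) =
      ∑' j, ENNReal.ofReal (‖ContinuousLinearMap.adjoint T (f j)‖ ^ 2) := by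
  simp_rw [← f.tsum_enorm_inner_sq (T (e _)), ← e.tsum_enorm_inner_sq]
  rw [ENNReal.tsum_comm]
  refine tsum_congr fun j => tsum_congr fun i => ?_
  rw [ContinuousLinearMap.adjoint_inner_right, ← inner_conj_symm, RCLike.norm_conj]

theorem summable_iff_tsum_ofReal_ne_top {ι : Type*} {a : ι → ℝ} (ha : ∀ i, 0 ≤ a i) :
    Summable a ↔ ∑' i, ENNReal.ofReal (a i) ≠ ∞ := by
  refine ⟨fun h => h.tsum_ofReal_ne_top, fun h => ?_⟩
  refine (ENNReal.summable_toReal h).congr fun i => ?_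
  rw [ENNReal.toReal_ofReal (ha i)]

theorem summable_norm_sq_adjoint {ι κ : Type*} (e : HilbertBasis ι ℂ H) (f : HilbertBasis κ ℂ H)
    (T : H →L[ℂ] H) :
    (Summable fun i => ‖T (e i)‖ ^ 2) ↔
      Summable fun j => ‖ContinuousLinearMap.adjoint T (f j)‖ ^ 2 := by
  rw [summable_iff_tsum_ofReal_ne_top fun _ => by positivity, tsum_norm_sq_adjoint e f,
    summable_iff_tsum_ofReal_ne_top fun _ => by positivity]

/-- Independence of the basis: pass to the adjoint in the other basis and back again. -/
theorem isHilbertSchmidt_iff {ι : Type*} (e : HilbertBasis ι ℂ H) (T : H →L[ℂ] H) :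
    IsHilbertSchmidt T ↔ Summable fun i => ‖T (e i)‖ ^ 2 := by
  obtain ⟨w, b, -⟩ := exists_hilbertBasis ℂ H
  refine ⟨fun ⟨w, f, hf⟩ => ?_, fun h => ⟨w, b, ?_⟩⟩
  · rwa [summable_norm_sq_adjoint e f, ← summable_norm_sq_adjoint f f]
  · rwa [summable_norm_sq_adjoint b e, ← summable_norm_sq_adjoint e e]

namespace IsHilbertSchmidt

variable {S T : H →L[ℂ] H}

theorem star (hT : IsHilbertSchmidt T) : IsHilbertSchmidt (star T) := by
  obtain ⟨w, e, h⟩ := hT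
  exact ⟨w, e, (summable_norm_sq_adjoint e e T).mp h⟩

theorem mul_left (hT : IsHilbertSchmidt T) (B : H →L[ℂ] H) : IsHilbertSchmidt (B * T) := by
  obtain ⟨w, e, h⟩ := hT
  refine ⟨w, e, (h.mul_left (‖B‖ ^ 2)).of_nonneg_of_le (fun _ => by positivity) fun i => ?_⟩
  rw [← mul_pow]
  exact pow_le_pow_left₀ (norm_nonneg _) (B.le_opNorm _) 2

theorem mul_right (hT : IsHilbertSchmidt T) (B : H →L[ℂ] H) : IsHilbertSchmidt (T * B) := by
  have h := (hT.star.mul_left (Star.star B)).star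
  rwa [star_mul, star_star, star_star] at h

theorem add (hS : IsHilbertSchmidt S) (hT : IsHilbertSchmidt T) : IsHilbertSchmidt (S + T) := by
  obtain ⟨w, e, h⟩ := hS
  refine ⟨w, e, ((h.add ((isHilbertSchmidt_iff e T).mp hT)).mul_left 2).of_nonneg_of_le
    (fun _ => by positivity) fun i => ?_⟩
  have h1 : ‖(S + T) (e i)‖ ≤ ‖S (e i)‖ + ‖T (e i)‖ := norm_add_le _ _
  have h2 := pow_le_pow_left₀ (norm_nonneg _) h1 2
  nlinarith [sq_nonneg (‖S (e i)‖ - ‖T (e i)‖)]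

theorem neg (hT : IsHilbertSchmidt T) : IsHilbertSchmidt (-T) := by
  simpa using hT.mul_left (-1)

theorem sub (hS : IsHilbertSchmidt S) (hT : IsHilbertSchmidt T) : IsHilbertSchmidt (S - T) := by
  rw [sub_eq_add_neg]
  exact hS.add hT.neg

end IsHilbertSchmidt

theorem re_inner_eq_norm_sqrt_sq {T : H →L[ℂ] H} (hT : 0 ≤ T) (x : H) :
    (⟪x, T x⟫_ℂ).re = ‖CFC.sqrt T x‖ ^ 2 := by
  have hs : IsSelfAdjoint (CFC.sqrt T) := (CFC.sqrt_nonneg T).isSelfAdjoint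
  conv_lhs => rw [← CFC.sqrt_mul_sqrt_self T hT]
  rw [mul_apply_eq_comp, ← ContinuousLinearMap.adjoint_inner_left,
    ← ContinuousLinearMap.star_eq_adjoint, hs.star_eq, inner_self_eq_norm_sq_to_K]
  norm_cast

theorem isTraceClass_iff_sqrt {T : H →L[ℂ] H} (hT : 0 ≤ T) :
    IsTraceClass T ↔ IsHilbertSchmidt (CFC.sqrt T) := by
  simp only [IsTraceClass, IsHilbertSchmidt, CFC.abs_of_nonneg T hT, re_inner_eq_norm_sqrt_sq hT]

theorem isTraceClass_iff {ι : Type*} {T : H →L[ℂ] H} (hT : 0 ≤ T) (e : HilbertBasis ι ℂ H) :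
    IsTraceClass T ↔ Summable fun i => (⟪e i, T (e i)⟫_ℂ).re := by
  rw [isTraceClass_iff_sqrt hT, isHilbertSchmidt_iff e]
  simp only [re_inner_eq_norm_sqrt_sq hT]

/-- This allows any operator with the same quadratic form to replace `√T`, in particular `√T * B`
for a conjugated operator. -/
theorem isTraceClass_iff_isHilbertSchmidt {S T : H →L[ℂ] H} (hT : 0 ≤ T)
    (h : ∀ x, (⟪x, T x⟫_ℂ).re = ‖S x‖ ^ 2) : IsTraceClass T ↔ IsHilbertSchmidt S := by
  obtain ⟨w, e, -⟩ := exists_hilbertBasis ℂ H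
  rw [isTraceClass_iff hT e, isHilbertSchmidt_iff e]
  simp only [h]

/-- The diagonal entries are nonnegative, so the comparison test splits the sum; no inequality for
the trace norm is needed. -/
theorem isTraceClass_add_iff {S T : H →L[ℂ] H} (hS : 0 ≤ S) (hT : 0 ≤ T) :
    IsTraceClass (S + T) ↔ IsTraceClass S ∧ IsTraceClass T := by
  obtain ⟨w, e, -⟩ := exists_hilbertBasis ℂ H
  rw [isTraceClass_iff hS e, isTraceClass_iff hT e, isTraceClass_iff (add_nonneg hS hT) e]
  have hp : ∀ {A : H →L[ℂ] H}, 0 ≤ A → ∀ i, 0 ≤ (⟪e i, A (e i)⟫_ℂ).re := fun hA i =>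
    ((ContinuousLinearMap.nonneg_iff_isPositive _).mp hA).re_inner_nonneg_right _
  simp only [_root_.add_apply, inner_add_right, Complex.add_re]
  refine ⟨fun h => ⟨?_, ?_⟩, fun h => h.1.add h.2⟩
  · exact h.of_nonneg_of_le (hp hS) fun i => le_add_of_nonneg_right (hp hT i)
  · exact h.of_nonneg_of_le (hp hT) fun i => le_add_of_nonneg_left (hp hS i)

theorem inner_diagonalBlock (D : H →L[ℂ] H) (E : Submodule ℂ H) [E.HasOrthogonalProjection]
    (x : E) : ⟪x, diagonalBlock D E x⟫_ℂ =
      ⟪(x : H), (E.starProjection * D * E.starProjection) x⟫_ℂ := by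
  have hx : E.starProjection (x : H) = x := Submodule.starProjection_eq_self_iff.mpr x.2
  rw [mul_apply_eq_comp, mul_apply_eq_comp, hx,
    ← Submodule.inner_starProjection_left_eq_right, hx, Submodule.coe_inner]
  change ⟪(x : H), (E.orthogonalProjectionOnto (D x) : H)⟫_ℂ = _
  rw [← Submodule.starProjection_apply, ← Submodule.inner_starProjection_left_eq_right, hx]

/-- A nonnegative compression is trace class on the subspace iff it is trace class on the whole
space. -/
theorem isTraceClass_diagonalBlock_iff (D : H →L[ℂ] H) (E : Submodule ℂ H)
    [E.HasOrthogonalProjection] [CompleteSpace E]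
    (hD : 0 ≤ E.starProjection * D * E.starProjection) :
    IsTraceClass (diagonalBlock D E) ↔
      IsTraceClass (E.starProjection * D * E.starProjection) := by
  have hblock : 0 ≤ diagonalBlock D E := by
    rw [ContinuousLinearMap.nonneg_iff_isPositive, ContinuousLinearMap.isPositive_iff_complex]
    have h0 := (ContinuousLinearMap.nonneg_iff_isPositive _).mp hD
    intro x
    have h1 : 0 ≤ ⟪x, diagonalBlock D E x⟫_ℂ := by
      rw [inner_diagonalBlock]
      exact h0.inner_nonneg_right _
    have hx := Complex.le_def.mp h1
    have hs : ⟪diagonalBlock D E x, x⟫_ℂ = ⟪x, diagonalBlock D E x⟫_ℂ := by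
      rw [← inner_conj_symm, Complex.conj_eq_iff_im.mpr hx.2.symm]
    rw [hs]
    exact ⟨Complex.ext rfl hx.2, hx.1⟩
  obtain ⟨v, f, hf⟩ := exists_hilbertBasis ℂ E
  have hon : Orthonormal ℂ fun i : v => (f i : H) :=
    f.orthonormal.comp_linearIsometry E.subtypeₗᵢ
  have hinj : Function.Injective fun i : v => (f i : H) := hon.linearIndependent.injective
  -- A Hilbert basis of `E` is extended to one of `H`. The added vectors are orthogonal to `E`, so
  -- the compression vanishes on them and both diagonals have the same nonzero terms.
  obtain ⟨w, e, hvw, he⟩ := hon.toSubtypeRange.exists_hilbertBasis_extension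
  rw [isTraceClass_iff hblock f, isTraceClass_iff hD e]
  let j : v → w := fun i => ⟨f i, hvw ⟨i, rfl⟩⟩
  have hj : Function.Injective j := fun a b h => hinj (congrArg (fun x : w => (x : H)) h)
  have hej : ∀ i, e (j i) = f i := fun i => by rw [he]
  rw [← hj.summable_iff]
  · refine summable_congr fun i => ?_
    rw [Function.comp_apply, hej, inner_diagonalBlock]
  · intro k hk
    have hperp : E.starProjection (e k) = 0 := by
      have hz : ∀ x : E, ⟪(x : H), e k⟫_ℂ = 0 := by
        intro x
        have hcl : IsClosed {x : E | ⟪(x : H), e k⟫_ℂ = 0} :=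
          isClosed_eq (by fun_prop) continuous_const
        have hsub : (Submodule.span ℂ (Set.range f) : Set E) ⊆ {x : E | ⟪(x : H), e k⟫_ℂ = 0} := by
          intro y hy
          induction hy using Submodule.span_induction with
          | mem y hy =>
            obtain ⟨i, rfl⟩ := hy
            change ⟪(f i : H), e k⟫_ℂ = 0
            rw [← hej]
            exact e.orthonormal.2 fun h => hk ⟨i, h⟩
          | zero => simp
          | add a b _ _ ha hb =>
            simp only [Set.mem_ofPred_eq] at ha hb ⊢
            rw [Submodule.coe_add, inner_add_left, ha, hb, add_zero]
          | smul c a _ ha =>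
            simp only [Set.mem_ofPred_eq] at ha ⊢
            rw [Submodule.coe_smul, inner_smul_left, ha, mul_zero]
        have hx : x ∈ (Submodule.span ℂ (Set.range f)).topologicalClosure := by
          rw [f.dense_span]; trivial
        exact closure_minimal hsub hcl hx
      refine Submodule.eq_starProjection_of_mem_orthogonal E.zero_mem ?_
      rw [sub_zero, Submodule.mem_orthogonal]
      exact fun u hu => hz ⟨u, hu⟩
    rw [mul_apply_eq_comp, hperp, map_zero, inner_zero_right, Complex.zero_re]

end OperatorIdeals

/-! ### Comparison of operators under `-Q ≤ A ≤ Q` -/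

section ComparisonOperators

variable {H : Type*} [NormedAddCommGroup H] [InnerProductSpace ℂ H] [CompleteSpace H]

/-- An antiunitary involution `G` carries a Hilbert basis to a Hilbert basis, and the diagonal of
`A` in the image basis is the conjugate of the diagonal of `B`. It serves to transport trace class
from one eigenspace block to the other. -/
theorem isTraceClass_of_conj {A B : H →L[ℂ] H} (hA : 0 ≤ A) (hB : 0 ≤ B) (G : H →ₗ⋆[ℂ] H)
    (hG : ∀ x, G (G x) = x) (hinner : ∀ x y, ⟪G x, G y⟫_ℂ = ⟪y, x⟫_ℂ)
    (hAB : ∀ x, A (G x) = G (B x)) (h : IsTraceClass B) : IsTraceClass A := by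
  obtain ⟨w, e, -⟩ := exists_hilbertBasis ℂ H
  have hon : Orthonormal ℂ fun i => G (e i) := by
    classical
    rw [orthonormal_iff_ite]
    intro i j
    rw [hinner, orthonormal_iff_ite.mp e.orthonormal]
    simp only [eq_comm]
  have hsp : (Submodule.span ℂ (Set.range fun i => G (e i)))ᗮ = ⊥ := by
    rw [Submodule.eq_bot_iff]
    intro x hx
    have h0 : ∀ i, ⟪e i, G x⟫_ℂ = 0 := fun i => by
      rw [← hG (e i), hinner, ← inner_conj_symm,
        (Submodule.mem_orthogonal _ _).mp hx _ (Submodule.subset_span ⟨i, rfl⟩), map_zero]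
    have h1 : G x = 0 := by
      have h2 := e.hasSum_norm_inner_sq (G x)
      simp only [h0, norm_zero, ne_eq, OfNat.ofNat_ne_zero, not_false_eq_true, zero_pow] at h2
      simpa using h2.unique hasSum_zero
    rw [← hG x, h1, map_zero]
  have hb := (isTraceClass_iff hA (HilbertBasis.mkOfOrthogonalEqBot hon hsp)).mpr
  refine hb (((isTraceClass_iff hB e).mp h).congr fun i => ?_)
  rw [HilbertBasis.coe_mkOfOrthogonalEqBot]
  rw [hAB, hinner, ← inner_conj_symm, Complex.conj_re]

variable {P Q : H →L[ℂ] H}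

/-- The Cauchy–Schwarz inequality for a form dominated by `Q` from both sides. -/
theorem norm_inner_sq_le_of_dominated {A : H →L[ℂ] H} (h₁ : 0 ≤ Q + A) (h₂ : 0 ≤ Q - A)
    (x y : H) : ‖⟪x, A y⟫_ℂ‖ ^ 2 ≤ (⟪x, Q x⟫_ℂ).re * (⟪y, Q y⟫_ℂ).re := by
  set S := CFC.sqrt (Q + A) with hS
  set S' := CFC.sqrt (Q - A) with hS'
  have key : ∀ {T : H →L[ℂ] H}, 0 ≤ T → ∀ x y : H,
      ⟪x, T y⟫_ℂ = ⟪CFC.sqrt T x, CFC.sqrt T y⟫_ℂ := by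
    intro T hT x y
    have hs : IsSelfAdjoint (CFC.sqrt T) := (CFC.sqrt_nonneg T).isSelfAdjoint
    conv_lhs => rw [← CFC.sqrt_mul_sqrt_self T hT]
    rw [mul_apply_eq_comp, ← ContinuousLinearMap.adjoint_inner_left,
      ← ContinuousLinearMap.star_eq_adjoint, hs.star_eq]
  have hq : ∀ x : H, (⟪x, Q x⟫_ℂ).re = (‖S x‖ ^ 2 + ‖S' x‖ ^ 2) / 2 := by
    intro x
    rw [← re_inner_eq_norm_sqrt_sq h₁, ← re_inner_eq_norm_sqrt_sq h₂, ← Complex.add_re,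
      ← inner_add_right, ← _root_.add_apply, add_add_sub_cancel, _root_.add_apply, inner_add_right,
      Complex.add_re]
    ring
  -- `2 A = (Q + A) - (Q - A)` while `2 Q` is the sum, so Cauchy–Schwarz is applied to each
  -- nonnegative form and then once more to the pairs of norms in `ℝ²`.
  have h : (2 : ℂ) * ⟪x, A y⟫_ℂ = ⟪S x, S y⟫_ℂ - ⟪S' x, S' y⟫_ℂ := by
    rw [← key h₁, ← key h₂, ← inner_sub_right, ← _root_.sub_apply,
      show Q + A - (Q - A) = A + A by abel, _root_.add_apply, inner_add_right]
    ring
  have hn : 2 * ‖⟪x, A y⟫_ℂ‖ ≤ ‖S x‖ * ‖S y‖ + ‖S' x‖ * ‖S' y‖ := by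
    have := congrArg norm h
    rw [norm_mul, Complex.norm_ofNat] at this
    rw [this]
    exact (norm_sub_le _ _).trans (add_le_add (norm_inner_le_norm _ _) (norm_inner_le_norm _ _))
  have h2 := pow_le_pow_left₀ (by positivity) hn 2
  rw [hq, hq]
  nlinarith [sq_nonneg (‖S x‖ * ‖S' y‖ - ‖S' x‖ * ‖S y‖)]

theorem nonneg_of_dominates {A : H →L[ℂ] H} (h₁ : 0 ≤ Q + A) (h₂ : 0 ≤ Q - A) : 0 ≤ Q := by
  have h : Q = (1 / 2 : ℝ) • ((Q + A) + (Q - A)) := by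
    rw [add_add_sub_cancel, ← two_smul ℝ, smul_smul]
    norm_num
  rw [h]
  exact smul_nonneg (by norm_num) (add_nonneg h₁ h₂)

/-- Since `A` is unitary with `A² = 1`, domination tested on the pair `x`, `A x` gives `‖x‖⁴ ≤ ⟨x, Q
x⟩ ‖Q‖ ‖x‖²`. So `Q` is bounded below by a multiple of `‖Q‖⁻¹`. -/
theorem isUnit_of_dominates {A : H →L[ℂ] H} (hA : A * A = 1) (hA' : star A = A)
    (h₁ : 0 ≤ Q + A) (h₂ : 0 ≤ Q - A) : IsUnit Q := by
  have hAA : ∀ x, A (A x) = x := fun x => by rw [← mul_apply_eq_comp, hA]; rfl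
  have hn : ∀ x, ‖A x‖ = ‖x‖ := by
    intro x
    have h : ⟪A x, A x⟫_ℂ = ⟪x, x⟫_ℂ := by
      conv_lhs => rw [← ContinuousLinearMap.adjoint_inner_right]
      rw [← ContinuousLinearMap.star_eq_adjoint, hA', hAA]
    have h2 : ‖A x‖ ^ 2 = ‖x‖ ^ 2 := by
      rw [inner_self_eq_norm_sq_to_K, inner_self_eq_norm_sq_to_K] at h
      exact_mod_cast h
    exact (pow_left_inj₀ (norm_nonneg _) (norm_nonneg _) two_ne_zero).mp h2
  have hq : ∀ x : H, (⟪x, Q x⟫_ℂ).re ≤ ‖Q‖ * ‖x‖ ^ 2 := fun x =>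
    calc (⟪x, Q x⟫_ℂ).re ≤ ‖⟪x, Q x⟫_ℂ‖ := Complex.re_le_norm _
      _ ≤ ‖x‖ * ‖Q x‖ := norm_inner_le_norm _ _
      _ ≤ ‖x‖ * (‖Q‖ * ‖x‖) := by gcongr; exact Q.le_opNorm x
      _ = _ := by ring
  -- The `+ 1` keeps the constant meaningful when `‖Q‖ = 0`, which happens on the zero space.
  refine ContinuousLinearMap.isUnit_of_forall_le_norm_inner_map Q
    (c := ⟨(‖Q‖ + 1)⁻¹, by positivity⟩) (by change (0 : ℝ) < (‖Q‖ + 1)⁻¹; positivity) fun x => ?_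
  have h := norm_inner_sq_le_of_dominated h₁ h₂ x (A x)
  rw [hAA, inner_self_eq_norm_sq_to_K] at h
  have h3 : ‖((‖x‖ : ℂ)) ^ 2‖ = ‖x‖ ^ 2 := by simp
  change ‖((‖x‖ : ℂ)) ^ 2‖ ^ 2 ≤ _ at h
  rw [h3] at h
  have h4 := hq (A x)
  rw [hn] at h4
  have h5 : (⟪x, Q x⟫_ℂ).re ≤ ‖⟪Q x, x⟫_ℂ‖ := by
    rw [← inner_conj_symm, Complex.conj_re]
    exact Complex.re_le_norm _
  change ‖x‖ ^ 2 * (‖Q‖ + 1)⁻¹ ≤ _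
  rw [← div_eq_mul_inv, div_le_iff₀ (by positivity)]
  by_cases hx : ‖x‖ = 0
  · simp [hx]
    positivity
  · have hx2 : 0 < ‖x‖ ^ 2 := by positivity
    have h6 : ‖x‖ ^ 2 * ‖x‖ ^ 2 ≤ (‖⟪Q x, x⟫_ℂ‖ * ‖Q‖) * ‖x‖ ^ 2 := by
      calc ‖x‖ ^ 2 * ‖x‖ ^ 2 = (‖x‖ ^ 2) ^ 2 := by ring
        _ ≤ _ := h
        _ ≤ ‖⟪Q x, x⟫_ℂ‖ * (⟪A x, Q (A x)⟫_ℂ).re := by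
          refine mul_le_mul_of_nonneg_right h5 ?_
          exact ((ContinuousLinearMap.nonneg_iff_isPositive _).mp
            (nonneg_of_dominates h₁ h₂)).re_inner_nonneg_right _
        _ ≤ ‖⟪Q x, x⟫_ℂ‖ * (‖Q‖ * ‖x‖ ^ 2) := by gcongr
        _ = _ := by ring
    have h7 := le_of_mul_le_mul_right h6 hx2
    nlinarith [norm_nonneg ⟪Q x, x⟫_ℂ]

theorem inner_star_mul_mul {B T : H →L[ℂ] H} (x : H) :
    ⟪x, (star B * T * B) x⟫_ℂ = ⟪B x, T (B x)⟫_ℂ := by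
  rw [mul_apply_eq_comp, mul_apply_eq_comp, ContinuousLinearMap.star_eq_adjoint,
    ContinuousLinearMap.adjoint_inner_right]

theorem isTraceClass_conj_iff {B T : H →L[ℂ] H} (hT : 0 ≤ T) :
    IsTraceClass (star B * T * B) ↔ IsHilbertSchmidt (CFC.sqrt T * B) := by
  refine isTraceClass_iff_isHilbertSchmidt (star_left_conjugate_nonneg hT B) fun x => ?_
  rw [inner_star_mul_mul, re_inner_eq_norm_sqrt_sq hT]
  rfl

/-! ### The inverse of `Q` and the bound `A Q⁻¹ A ≤ Q` -/

section Inverse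

variable {A V : H →L[ℂ] H}

theorem star_inverse_eq (hQ : star Q = Q) (hQV : Q * V = 1) : star V = V := by
  have h : star V * Q = 1 := by
    have := congrArg star hQV
    rwa [star_mul, hQ, star_one] at this
  calc star V = star V * (Q * V) := by rw [hQV, mul_one]
    _ = V := by rw [← mul_assoc, h, one_mul]

theorem inverse_nonneg (hQ : 0 ≤ Q) (hVQ : V * Q = 1) (hQV : Q * V = 1) : 0 ≤ V := by
  have h := star_left_conjugate_nonneg hQ V
  rwa [star_inverse_eq hQ.isSelfAdjoint.star_eq hQV, hVQ, one_mul] at h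

/-- Domination tested on `x` and `Q⁻¹ A x` reads `r² ≤ ⟨x, Q x⟩ r` with `r = ⟨x, A Q⁻¹ A x⟩ ≥ 0`;
dividing by `r` gives the bound. -/
theorem conj_inverse_le (hA' : star A = A) (h₁ : 0 ≤ Q + A) (h₂ : 0 ≤ Q - A)
    (hQV : Q * V = 1) : 0 ≤ Q - A * V * A := by
  have hQ := nonneg_of_dominates h₁ h₂
  have hQs : star Q = Q := hQ.isSelfAdjoint.star_eq
  have hVs := star_inverse_eq hQs hQV
  rw [ContinuousLinearMap.nonneg_iff_isPositive, ContinuousLinearMap.isPositive_def']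
  refine ⟨?_, fun x => ?_⟩
  · rw [IsSelfAdjoint, star_sub, star_mul, star_mul, hQs, hVs, hA', mul_assoc]
  · have hQVx : ∀ z, Q (V z) = z := fun z => by rw [← mul_apply_eq_comp, hQV]; rfl
    have hAsym : ∀ y z : H, ⟪A y, z⟫_ℂ = ⟪y, A z⟫_ℂ := fun y z => by
      rw [← ContinuousLinearMap.adjoint_inner_right, ← ContinuousLinearMap.star_eq_adjoint, hA']
    rw [ContinuousLinearMap.reApplyInnerSelf_apply]
    set r := (⟪x, A (V (A x))⟫_ℂ).re with hr
    have hy : (⟪V (A x), Q (V (A x))⟫_ℂ).re = r := by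
      rw [hQVx, ← inner_conj_symm, Complex.conj_re, hAsym]
    have hr0 : 0 ≤ r := by
      rw [← hy]
      exact ((ContinuousLinearMap.nonneg_iff_isPositive _).mp hQ).re_inner_nonneg_right _
    have h := norm_inner_sq_le_of_dominated h₁ h₂ x (V (A x))
    rw [hy] at h
    have h3 : r ≤ ‖⟪x, A (V (A x))⟫_ℂ‖ := Complex.re_le_norm _
    have h4 : r * r ≤ (⟪x, Q x⟫_ℂ).re * r := by nlinarith
    have h0 : 0 ≤ (⟪x, Q x⟫_ℂ).re :=
      ((ContinuousLinearMap.nonneg_iff_isPositive _).mp hQ).re_inner_nonneg_right _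
    have h5 : r ≤ (⟪x, Q x⟫_ℂ).re := by
      rcases hr0.eq_or_lt with h6 | h6
      · rw [← h6]; exact h0
      · exact le_of_mul_le_mul_right h4 h6
    rw [← inner_conj_symm, RCLike.conj_re, _root_.sub_apply, inner_sub_right]
    change 0 ≤ (⟪x, Q x⟫_ℂ - ⟪x, A (V (A x))⟫_ℂ).re
    rw [Complex.sub_re]
    linarith

end Inverse

/-! ### Diagonal blocks of `Q - 1` -/

section Blocks

variable (hP : P * P = P) (hPs : star P = P)
  (hX : 0 ≤ Q - 1 + (P + P)) (hX' : 0 ≤ Q - 1 + ((1 - P) + (1 - P)))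

include hP hPs hX'

-- The term `2 (1 - P)` is invisible under compression by `P`, but adding it makes the middle
-- operator nonnegative. This is the source of positivity of the blocks.
omit hX' in
theorem compression_eq : P * (Q - 1) * P = star P * (Q - 1 + ((1 - P) + (1 - P))) * P := by
  have h : (1 - P) * P = 0 := by rw [sub_mul, one_mul, hP, sub_self]
  rw [hPs, mul_add, add_mul, mul_assoc P ((1 - P) + (1 - P)), add_mul (1 - P), h, add_zero,
    mul_zero, add_zero]

theorem compression_nonneg : 0 ≤ P * (Q - 1) * P := by
  rw [compression_eq hP hPs]
  exact star_left_conjugate_nonneg hX' P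

theorem isTraceClass_compression_iff : IsTraceClass (P * (Q - 1) * P) ↔
    IsHilbertSchmidt (CFC.sqrt (Q - 1 + ((1 - P) + (1 - P))) * P) := by
  rw [compression_eq hP hPs, isTraceClass_conj_iff hX']

/-- A trace class block controls the off-diagonal part too: it says that `√(Q - A) P` is
Hilbert–Schmidt, where `A = 2 P - 1`, and multiplying by `√(Q - A)` gives `(Q - A) P = (Q - 1) P`.
-/
theorem isHilbertSchmidt_mul_of_isTraceClass_compression (h : IsTraceClass (P * (Q - 1) * P)) :
    IsHilbertSchmidt ((Q - 1) * P) := by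
  have h0 : (1 - P) * P = 0 := by rw [sub_mul, one_mul, hP, sub_self]
  have h1 := ((isTraceClass_compression_iff hP hPs hX').mp h).mul_left
    (CFC.sqrt (Q - 1 + ((1 - P) + (1 - P))))
  rwa [← mul_assoc, CFC.sqrt_mul_sqrt_self _ hX', add_mul, add_mul (1 - P), h0, add_zero,
    add_zero] at h1

include hX

theorem isHilbertSchmidt_sub_one_of_isTraceClass_compression
    (h : IsTraceClass (P * (Q - 1) * P)) (h' : IsTraceClass ((1 - P) * (Q - 1) * (1 - P))) :
    IsHilbertSchmidt (Q - 1) := by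
  have hP' : (1 - P) * (1 - P) = 1 - P := IsIdempotentElem.one_sub hP
  have hPs' : star (1 - P) = 1 - P := by rw [star_sub, star_one, hPs]
  have h1 := isHilbertSchmidt_mul_of_isTraceClass_compression hP hPs hX' h
  have h2 := isHilbertSchmidt_mul_of_isTraceClass_compression hP' hPs'
    (by rwa [sub_sub_cancel]) h'
  have h3 := h1.add h2
  rwa [← mul_add, add_sub_cancel, mul_one] at h3

/-- The diagonal blocks of `Q - 1` are trace class iff `Q - 1` is Hilbert–Schmidt and
`Q - A Q⁻¹ A` is trace class, where `A = 2 P - 1`. -/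
theorem isTraceClass_compressions_iff {V : H →L[ℂ] H} (hVQ : V * Q = 1) (hQV : Q * V = 1) :
    (IsTraceClass (P * (Q - 1) * P) ∧ IsTraceClass ((1 - P) * (Q - 1) * (1 - P))) ↔
      IsHilbertSchmidt (Q - 1) ∧ IsTraceClass (Q - (P + P - 1) * V * (P + P - 1)) := by
  have hP' : (1 - P) * (1 - P) = 1 - P := IsIdempotentElem.one_sub hP
  have hPs' : star (1 - P) = 1 - P := by rw [star_sub, star_one, hPs]
  set A := P + P - 1 with hA
  have hAs : star A = A := by rw [hA, star_sub, star_add, star_one, hPs]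
  have hXA : 0 ≤ Q + A := by convert hX using 1; rw [hA]; abel
  have hXA' : 0 ≤ Q - A := by convert hX' using 1; rw [hA]; abel
  have hAA : A * A = 1 := by
    rw [hA, sub_mul, mul_sub, add_mul, mul_add, hP]; noncomm_ring
  have hQ := nonneg_of_dominates hXA hXA'
  have hY := conj_inverse_le hAs hXA hXA' hQV
  have hV := inverse_nonneg hQ hVQ hQV
  set D := Q - 1 with hD
  have hDs : star D = D := by rw [hD, star_sub, star_one, hQ.isSelfAdjoint.star_eq]
  have hZ : 0 ≤ star (D * A) * V * (D * A) := star_left_conjugate_nonneg hV _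
  have hB := compression_nonneg hP hPs hX'
  have hB' := compression_nonneg hP' hPs' (Q := Q) (by rwa [sub_sub_cancel])
  -- The Neumann expansion of `Q⁻¹ = (1 + D)⁻¹` to first order with exact remainder: `Q⁻¹ = 1 - D +
  -- D Q⁻¹ D`.
  have hDVD : D * V * D = D - 1 + V := by
    have h1 : D * V = 1 - V := by rw [hD, sub_mul, hQV, one_mul]
    have h2 : V * D = 1 - V := by rw [hD, mul_sub, hVQ, mul_one]
    rw [h1, sub_mul, one_mul, h2]
    abel
  -- After substitution the left side is `D + A D A`. Conjugation by the reflection `A` flips the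
  -- sign of the off-diagonal blocks, so only twice the diagonal part survives.
  have hsum : (Q - A * V * A) + star (D * A) * V * (D * A) =
      (P * D * P + (1 - P) * D * (1 - P)) + (P * D * P + (1 - P) * D * (1 - P)) := by
    have h1 : star (D * A) * V * (D * A) = A * (D * V * D) * A := by
      rw [star_mul, hAs, hDs]; simp only [mul_assoc]
    have h2 : A * (D - 1 + V) * A = A * D * A - 1 + A * V * A := by
      rw [mul_add A, mul_sub A, add_mul _ _ A, sub_mul _ _ A, mul_one A, hAA]
    rw [h1, hDVD, h2, show Q = D + 1 by rw [hD]; abel, hA]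
    noncomm_ring
  have hHS : IsHilbertSchmidt D → IsTraceClass (star (D * A) * V * (D * A)) := fun h =>
    (isTraceClass_conj_iff hV).mpr ((h.mul_right A).mul_left _)
  have hBB := add_nonneg hB hB'
  have hiff : IsHilbertSchmidt D → (IsTraceClass (Q - A * V * A) ↔
      (IsTraceClass (P * D * P) ∧ IsTraceClass ((1 - P) * D * (1 - P)))) := by
    intro h
    have h1 := isTraceClass_add_iff hY hZ
    rw [hsum, isTraceClass_add_iff hBB hBB, isTraceClass_add_iff hB hB', and_self_iff] at h1
    rw [h1]
    exact (and_iff_left (hHS h)).symm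
  refine ⟨fun h => ?_, fun h => (hiff h.1).mp h.2⟩
  have h1 := isHilbertSchmidt_sub_one_of_isTraceClass_compression hP hPs hX hX' h.1 h.2
  exact ⟨h1, (hiff h1).mpr h⟩

end Blocks

omit [CompleteSpace H] in
theorem sqrt_two_smul_mul_self (hP : P * P = P) :
    (((√2 : ℝ) : ℂ) • P) * (((√2 : ℝ) : ℂ) • P) = P + P := by
  rw [smul_mul_smul_comm, hP, ← Complex.ofReal_mul, Real.mul_self_sqrt (by norm_num),
    ← two_smul ℂ P]
  norm_num

theorem sqrt_projection_add_self (hP : P * P = P) (hPs : star P = P) :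
    CFC.sqrt (P + P) = ((√2 : ℝ) : ℂ) • P := by
  have hP0 : 0 ≤ P := by
    have := star_mul_self_nonneg P
    rwa [hPs, hP] at this
  have h0 : (0 : ℂ) ≤ ((√2 : ℝ) : ℂ) := Complex.zero_le_real.mpr (Real.sqrt_nonneg 2)
  have h1 : 0 ≤ ((√2 : ℝ) : ℂ) • P := by
    rw [ContinuousLinearMap.nonneg_iff_isPositive] at hP0 ⊢
    exact hP0.smul_of_nonneg h0
  exact CFC.sqrt_unique (sqrt_two_smul_mul_self hP) h1

/-! ### Differences of square roots -/

section Sqrt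

variable (hP : P * P = P) (hPs : star P = P)
  (hX : 0 ≤ Q - 1 + (P + P)) (hX' : 0 ≤ Q - 1 + ((1 - P) + (1 - P)))

include hP hPs hX hX'

/-- `√X₂ - √X₁` is Hilbert–Schmidt iff both diagonal blocks of `X₂ - X₁` are trace class. -/
theorem isHilbertSchmidt_sqrt_sub_sqrt_iff (G : H →ₗ⋆[ℂ] H) (hG : ∀ x, G (G x) = x)
    (hinner : ∀ x y, ⟪G x, G y⟫_ℂ = ⟪y, x⟫_ℂ) (hGP : ∀ x, P (G x) = G (x - P x))
    (hGQ : ∀ x, Q (G x) = G (Q x)) :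
    IsHilbertSchmidt (CFC.sqrt (Q - 1 + (P + P)) - CFC.sqrt (P + P)) ↔
      IsTraceClass (P * (Q - 1) * P) ∧ IsTraceClass ((1 - P) * (Q - 1) * (1 - P)) := by
  have hP' : (1 - P) * (1 - P) = 1 - P := IsIdempotentElem.one_sub hP
  have hPs' : star (1 - P) = 1 - P := by rw [star_sub, star_one, hPs]
  have hPP' : P * (1 - P) = 0 := by rw [mul_sub, mul_one, hP, sub_self]
  have hB := compression_nonneg hP hPs hX'
  have hB' := compression_nonneg hP' hPs' (Q := Q) (by rwa [sub_sub_cancel])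
  have hTC' := isTraceClass_compression_iff hP' hPs' (Q := Q) (by rwa [sub_sub_cancel])
  rw [sub_sub_cancel] at hTC'
  rw [sqrt_projection_add_self hP hPs]
  set S := CFC.sqrt (Q - 1 + (P + P)) with hS
  have hS0 : 0 ≤ S := CFC.sqrt_nonneg _
  have hSs : star S = S := hS0.isSelfAdjoint.star_eq
  have hSS : S * S = Q - 1 + (P + P) := CFC.sqrt_mul_sqrt_self _ hX
  set c : ℂ := ((√2 : ℝ) : ℂ) with hc
  have hcc : (c • P) * (c • P) = P + P := sqrt_two_smul_mul_self hP
  constructor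
  · intro h
    -- Multiplying by `1 - P` removes `√X₁ = √2 P` and leaves `√X₂ (1 - P)`, a square root factor of
    -- the block on the range of `1 - P`. The other block is its image under the conjugation `G`,
    -- which exchanges `P` and `1 - P` and commutes with `Q`.
    have h1 := h.mul_right (1 - P)
    rw [sub_mul, smul_mul_assoc, hPP', smul_zero, sub_zero] at h1
    have h2 := hTC'.mpr h1
    refine ⟨isTraceClass_of_conj hB hB' G hG hinner (fun x => ?_) h2, h2⟩
    simp only [mul_apply_eq_comp, _root_.sub_apply, one_apply_eq_self, hGP, hGQ, ← map_sub]
  · rintro ⟨h1, h2⟩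
    have hSP' := hTC'.mp h2
    have hP'S : IsHilbertSchmidt ((1 - P) * S) := by
      have := hSP'.star
      rwa [star_mul, hSs, hPs'] at this
    have hDP := isHilbertSchmidt_mul_of_isTraceClass_compression hP hPs hX' h1
    have hc0 : (0 : ℝ) < √2 := by positivity
    have hs0 : 0 ≤ P * S * P := by
      have := star_left_conjugate_nonneg hS0 P
      rwa [hPs] at this
    -- `P S P + √2` is invertible
    have hunit : IsUnit (P * S * P + c • (1 : H →L[ℂ] H)) := by
      refine ContinuousLinearMap.isUnit_of_forall_le_norm_inner_map _
        (c := ⟨√2, hc0.le⟩) hc0 fun x => ?_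
      have h3 := ((ContinuousLinearMap.nonneg_iff_isPositive _).mp hs0).re_inner_nonneg_left x
      change 0 ≤ (⟪(P * S * P) x, x⟫_ℂ).re at h3
      refine le_trans ?_ (Complex.re_le_norm _)
      have h4 : ⟪(P * S * P + c • (1 : H →L[ℂ] H)) x, x⟫_ℂ =
          ⟪(P * S * P) x, x⟫_ℂ + ((√2 * ‖x‖ ^ 2 : ℝ) : ℂ) := by
        rw [_root_.add_apply, inner_add_left]
        congr 1
        change ⟪c • x, x⟫_ℂ = _
        rw [inner_smul_left, hc, Complex.conj_ofReal, inner_self_eq_norm_sq_to_K]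
        push_cast
        rfl
      rw [h4, Complex.add_re, Complex.ofReal_re]
      change ‖x‖ ^ 2 * √2 ≤ _
      linarith
    obtain ⟨u, hu⟩ := hunit
    -- A difference of squares on the range of `P`, with `(P S P)² = P S² P - P S (1 - P) S P` and
    -- `P S² P = P (Q - 1) P + 2 P`. The right side is Hilbert–Schmidt, and the first factor on the
    -- left can be inverted.
    have hprod : (P * S * P + c • (1 : H →L[ℂ] H)) * (P * S * P - c • P) =
        P * ((Q - 1) * P) - P * (S * (1 - P)) * ((1 - P) * S) * P := by
      have e1 : P * S * P * (P * S * P) = P * (S * P * S) * P := by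
        calc P * S * P * (P * S * P) = P * S * (P * P) * S * P := by simp only [mul_assoc]
          _ = _ := by rw [hP]; simp only [mul_assoc]
      have e2 : P * (S * (1 - P)) * ((1 - P) * S) * P = P * (S * S) * P - P * (S * P * S) * P := by
        calc P * (S * (1 - P)) * ((1 - P) * S) * P = P * S * ((1 - P) * (1 - P)) * S * P := by
              simp only [mul_assoc]
          _ = _ := by rw [hP']; noncomm_ring
      have e3 : P * (S * S) * P = P * ((Q - 1) * P) + (P + P) := by
        rw [hSS, mul_add, add_mul, mul_assoc, mul_add, add_mul, hP, hP]
      have e4 : P * S * P * (c • P) = c • (P * S * P) := by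
        rw [mul_smul_comm, mul_assoc, hP]
      have e5 : (c • (1 : H →L[ℂ] H)) * (c • P) = P + P := by
        rw [← hcc, smul_mul_smul_comm, smul_mul_smul_comm, one_mul, hP]
      rw [e2, e3, add_mul, mul_sub, mul_sub, e1, e4, e5, smul_mul_assoc, one_mul]
      abel
    have hPSP : IsHilbertSchmidt (P * S * P - c • P) := by
      have h3 : IsHilbertSchmidt
          (P * ((Q - 1) * P) - P * (S * (1 - P)) * ((1 - P) * S) * P) :=
        (hDP.mul_left P).sub (((hSP'.mul_left P).mul_right _).mul_right P)
      rw [← hprod, ← hu] at h3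
      have h4 := h3.mul_left (↑u⁻¹ : H →L[ℂ] H)
      rwa [← mul_assoc, Units.inv_mul, one_mul] at h4
    have hdec : S - c • P = (P * S * P - c • P) + S * (1 - P) + ((1 - P) * S) * P := by
      noncomm_ring
    rw [hdec]
    exact (hPSP.add hSP').add (hP'S.mul_right P)

end Sqrt

end ComparisonOperators

/-! ### Wick's recursion -/

section Wick

variable {V : Type*}

/-- All ways of removing one entry from a list. -/
def List.removals {α : Type*} : List α → List (α × List α)
  | [] => []
  | a :: l => (a, l) :: (removals l).map fun p => (p.1, a :: p.2)

theorem List.mem_removals {α : Type*} {l : List α} {p : α × List α} (hp : p ∈ l.removals) :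
    p.1 ∈ l ∧ (∀ a ∈ p.2, a ∈ l) ∧ p.2.length + 1 = l.length := by
  induction l generalizing p with
  | nil => simp [List.removals] at hp
  | cons a l ih =>
    simp only [List.removals, List.mem_cons, List.mem_map] at hp
    rcases hp with rfl | ⟨q, hq, rfl⟩
    · exact ⟨by simp, fun b hb => by simp [hb], by simp⟩
    · obtain ⟨h1, h2, h3⟩ := ih hq
      refine ⟨by simp [h1], fun b hb => ?_, by simp [h3]⟩
      rcases List.mem_cons.mp hb with rfl | hb
      · simp
      · simp [h2 b hb]

/-- The recursion for the correlation functions of a Gaussian functional with truncated two-point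
function `B` and mean `s`. -/
def IsWick (B : V → V → ℂ) (s : V → ℂ) (G : List V → ℂ) : Prop :=
  G [] = 1 ∧ ∀ f l, G (f :: l) = s f * G l + (l.removals.map fun p => B f p.1 * G p.2).sum

/-- The recursion shortens the list and evaluates the covariance only on its letters, so agreement
on a set containing them suffices. This is what permits replacing the one-particle space by a
finite-dimensional one. -/
theorem IsWick.eq_of_eqOn {B B' : V → V → ℂ} {s : V → ℂ} {G G' : List V → ℂ}
    (h : IsWick B s G) (h' : IsWick B' s G') (U : Set V)
    (hB : ∀ f ∈ U, ∀ g ∈ U, B f g = B' f g) (l : List V) (hl : ∀ f ∈ l, f ∈ U) : G l = G' l := by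
  induction hn : l.length using Nat.strong_induction_on generalizing l with
  | _ n ih =>
    cases l with
    | nil => rw [h.1, h'.1]
    | cons f l =>
      have hlU : ∀ g ∈ l, g ∈ U := fun g hg => hl g (List.mem_cons_of_mem _ hg)
      simp only [List.length_cons] at hn
      rw [h.2, h'.2, ih l.length (by omega) l hlU rfl]
      congr 2
      refine List.map_congr_left fun p hp => ?_
      obtain ⟨h1, h2, h3⟩ := List.mem_removals hp
      rw [hB f (hl f List.mem_cons_self) p.1 (hlU _ h1),
        ih p.2.length (by omega) p.2 (fun a ha => hlU a (h2 a ha)) rfl]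

/-- Vacuum expectation values of operators that are sums of creators, annihilators and scalars
satisfy Wick's recursion. -/
theorem isWick_vacuum {M : Type*} [AddCommGroup M] [Module ℂ M] (ρ D : V → M →ₗ[ℂ] M) (v : M)
    (lam : M →ₗ[ℂ] ℂ) (B : V → V → ℂ) (s : V → ℂ)
    (hlam : ∀ f q, lam (ρ f q) = lam (D f q) + s f * lam q)
    (hcomm : ∀ f g q, D f (ρ g q) = ρ g (D f q) + B f g • q)
    (hD : ∀ f, D f v = 0) (hv : lam v = 1) :
    IsWick B s fun l : List V => lam (l.foldr (fun f q => ρ f q) v) := by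
  -- The annihilator is commuted to the right through the word until it kills `v`; each passage
  -- leaves one contraction and deletes one letter.
  have key : ∀ (f : V) (l : List V), D f (l.foldr (fun f q => ρ f q) v) =
      (l.removals.map fun p => B f p.1 • p.2.foldr (fun f q => ρ f q) v).sum := by
    intro f l
    induction l with
    | nil => simpa [List.removals] using hD f
    | cons g l ih =>
      rw [List.foldr_cons, hcomm, ih, List.removals, List.map_cons, List.sum_cons, add_comm]
      congr 1
      rw [List.map_map, map_list_sum, List.map_map]
      congr 1
      refine List.map_congr_left fun p _ => ?_
      simp
  refine ⟨hv, fun f l => ?_⟩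
  change lam (ρ f (l.foldr (fun f q => ρ f q) v)) = _
  rw [hlam, key, add_comm, map_list_sum, List.map_map]
  congr 2
  refine List.map_congr_left fun p _ => ?_
  simp

namespace FieldState

theorem sum_map_splits_cons {α : Type*} (a : α) (l : List α) (k : List α × List α → ℂ) :
    ((splits (a :: l)).map k).sum = ((splits l).map fun p => k (a :: p.1, p.2)).sum +
      ((splits l).map fun p => k (p.1, a :: p.2)).sum := by
  rw [splits]
  induction splits l with
  | nil => simp
  | cons p m ih =>
    simp only [List.flatMap_cons, List.map_append, List.sum_append, ih, List.map_cons,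
      List.sum_cons, List.map_nil, List.sum_nil]
    ring

/-- The recursion defining connected correlators omits the unique splitting with empty complement,
since that term is the connected correlator being defined; this puts it back. -/
theorem sum_splits_eq_of_snd_nil {α : Type*} (h : List α × List α → ℂ) (l : List α) :
    h (l, []) + ((splits l).map fun p => if p.2 = [] then 0 else h p).sum =
      ((splits l).map h).sum := by
  induction l generalizing h with
  | nil => simp [splits]
  | cons a l ih =>
    rw [sum_map_splits_cons, sum_map_splits_cons, ← ih fun p => h (a :: p.1, p.2)]
    simp only [List.cons_ne_nil, if_false]
    ring

/-- For a Gaussian state `c m` is the connected correlator of `f :: m`, which vanishes unless `m` is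
a single letter. Only the contractions of `f` with one letter remain, and the sum over splittings
becomes Wick's sum. -/
theorem sum_splits_of_support {α : Type*} (c d : List α → ℂ)
    (hc : ∀ l, l.length ≠ 1 → c l = 0) (l : List α) :
    ((splits l).map fun p => c p.1 * d p.2).sum =
      (l.removals.map fun p => c [p.1] * d p.2).sum := by
  have h0 : ∀ (c d : List α → ℂ) (_ : ∀ l, l ≠ [] → c l = 0) (l : List α),
      ((splits l).map fun p => c p.1 * d p.2).sum = c [] * d l := by
    intro c d hc l
    induction l generalizing d with
    | nil => simp [splits]
    | cons a l ih =>
      rw [sum_map_splits_cons, ih fun m => d (a :: m)]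
      simp [hc]
  induction l generalizing d with
  | nil => simp [splits, List.removals, hc]
  | cons a l ih =>
    rw [sum_map_splits_cons, ih fun m => d (a :: m), List.removals, List.map_cons, List.sum_cons, List.map_map]
    congr 1
    refine h0 (fun m => c (a :: m)) d (fun m hm => hc _ ?_) l
    simpa using hm

variable [AddCommGroup V] [Module ℂ V] [StarAddMonoid V] [StarModule ℂ V] {Ω : CommutatorForm V}

theorem correlator_nil (ω : FieldState Ω) : ω.correlator [] = 1 := ω.eval_one

/-- Wick's theorem for zero-mean Gaussian states. -/
theorem IsZeroMeanGaussian.isWick {ω : FieldState Ω} (h : ω.IsZeroMeanGaussian) :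
    IsWick (fun f g => ω.eval (Ω.field f * Ω.field g)) (fun _ => 0) ω.correlator := by
  have h1 : ∀ f, ω.connected [f] = 0 := by
    intro f
    rw [connected_cons]
    simp [splits, correlator, h.1]
  have h2 : ∀ f g, ω.connected [f, g] = ω.eval (Ω.field f * Ω.field g) := by
    intro f g
    rw [connected_cons]
    simp [splits, correlator, h.1]
  refine ⟨ω.correlator_nil, fun f l => ?_⟩
  have h3 := sum_splits_eq_of_snd_nil (fun p => ω.connected (f :: p.1) * ω.correlator p.2) l
  have h4 := ω.connected_cons f l
  rw [sum_splits_of_support (fun m => ω.connected (f :: m)) ω.correlator] at h3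
  · simp only [h2] at h3
    rw [← h3, ω.correlator_nil]
    linear_combination -h4
  · intro m hm
    rcases m with _ | ⟨a, _ | ⟨b, m⟩⟩
    · exact h1 f
    · simp at hm
    · exact h.2 _ (by simp)

end FieldState

end Wick

/-! ### A Fock representation -/

section Fock

variable {V ι : Type*} [AddCommGroup V] [Module ℂ V]
  (b : Module.Basis ι ℂ V) (B : V →ₗ[ℂ] V →ₗ[ℂ] ℂ) (ψ : V →ₗ[ℂ] ℂ)

namespace FockModel

open MvPolynomial

/-- The creation polynomial of a test function. -/
noncomputable def creator : V →ₗ[ℂ] MvPolynomial (Option ι) ℂ := b.constr ℂ fun i => X (some i)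

/-- The annihilation operator of a test function. -/
noncomputable def annihilator (f : V) : Derivation ℂ (MvPolynomial (Option ι) ℂ) (MvPolynomial (Option ι) ℂ) :=
  mkDerivation ℂ fun o => o.elim 0 fun i => C (B f (b i))

theorem annihilator_creator (f g : V) : annihilator b B f (creator b g) = C (B f g) := by
  have h : (annihilator b B f : MvPolynomial (Option ι) ℂ →ₗ[ℂ] MvPolynomial (Option ι) ℂ) ∘ₗ
      creator b = (Algebra.linearMap ℂ (MvPolynomial (Option ι) ℂ)) ∘ₗ B f := by
    refine b.ext fun i => ?_
    simp [creator, annihilator, mkDerivation_X, MvPolynomial.algebraMap_eq]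
  exact LinearMap.congr_fun h g

theorem annihilator_X_none (f : V) : annihilator b B f (X none) = 0 := by
  simp [annihilator, mkDerivation_X]

theorem annihilator_comm (f g : V) (q : MvPolynomial (Option ι) ℂ) :
    annihilator b B f (annihilator b B g q) = annihilator b B g (annihilator b B f q) := by
  have h : ⁅annihilator b B f, annihilator b B g⁆ = 0 := by
    refine derivation_ext fun o => ?_
    rw [Derivation.commutator_apply]
    cases o <;> simp [annihilator, mkDerivation_X]
  have h2 := congrArg (fun D => D q) h
  simp only [Derivation.commutator_apply, Derivation.zero_apply] at h2
  exact sub_eq_zero.mp h2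

/-- The field operators: creators plus annihilators plus a classical Gaussian variable. -/
noncomputable def fieldOp : V →ₗ[ℂ] Module.End ℂ (MvPolynomial (Option ι) ℂ) where
  toFun f := LinearMap.mulLeft ℂ (creator b f + ψ f • X none) +
    (annihilator b B f : MvPolynomial (Option ι) ℂ →ₗ[ℂ] MvPolynomial (Option ι) ℂ)
  map_add' f g := by
    have h : annihilator b B (f + g) = annihilator b B f + annihilator b B g := by
      refine derivation_ext fun o => ?_
      cases o <;> simp [annihilator, mkDerivation_X]
    refine LinearMap.ext fun q => ?_
    simp only [h, map_add, LinearMap.add_apply, LinearMap.mulLeft_apply, Derivation.coeFn_coe,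
      Derivation.add_apply, add_smul]
    ring
  map_smul' c f := by
    have h : annihilator b B (c • f) = c • annihilator b B f := by
      refine derivation_ext fun o => ?_
      cases o <;> simp [annihilator, mkDerivation_X, smul_eq_C_mul]
    refine LinearMap.ext fun q => ?_
    simp only [h, map_smul, LinearMap.add_apply, LinearMap.mulLeft_apply, Derivation.coeFn_coe,
      Derivation.smul_apply, smul_assoc, RingHom.id_apply, LinearMap.smul_apply, smul_add, add_mul,
      smul_mul_assoc]

theorem fieldOp_apply (f : V) (q : MvPolynomial (Option ι) ℂ) :
    fieldOp b B ψ f q = (creator b f + ψ f • X none) * q + annihilator b B f q := rfl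

/-- Annihilators are commuting derivations that ignore the classical variable, so the commutator
with a field operator is the scalar `B f g`. -/
theorem annihilator_fieldOp (f g : V) (q : MvPolynomial (Option ι) ℂ) :
    annihilator b B f (fieldOp b B ψ g q) =
      fieldOp b B ψ g (annihilator b B f q) + B f g • q := by
  rw [fieldOp_apply, fieldOp_apply, map_add, Derivation.leibniz, map_add,
    Derivation.map_smul, annihilator_creator, annihilator_X_none, annihilator_comm b B f g]
  simp only [smul_eq_C_mul, smul_eq_mul]
  ring

/-- Differentiation in the classical variable acts as its annihilator and produces the contraction
`ψ g`. -/
theorem pderiv_none_fieldOp (g : V) (q : MvPolynomial (Option ι) ℂ) :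
    pderiv none (fieldOp b B ψ g q) = fieldOp b B ψ g (pderiv none q) + ψ g • q := by
  have h : pderiv none (creator b g) = 0 := by
    have h : (pderiv none : Derivation ℂ (MvPolynomial (Option ι) ℂ) _).toLinearMap ∘ₗ
        creator b = 0 := by
      refine b.ext fun i => ?_
      simp [creator, pderiv_X_of_ne]
    exact LinearMap.congr_fun h g
  have h2 : pderiv none (annihilator b B g q) = annihilator b B g (pderiv none q) := by
    have h : ⁅(pderiv none : Derivation ℂ (MvPolynomial (Option ι) ℂ) _),
        annihilator b B g⁆ = 0 := by
      classical
      refine derivation_ext fun o => ?_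
      rw [Derivation.commutator_apply]
      cases o <;> simp [annihilator, mkDerivation_X, pderiv_X]
    have h2 := congrArg (fun D => D q) h
    simp only [Derivation.commutator_apply, Derivation.zero_apply] at h2
    exact sub_eq_zero.mp h2
  rw [fieldOp_apply, fieldOp_apply, map_add, Derivation.leibniz, map_add,
    Derivation.map_smul, h, pderiv_X_self, h2]
  simp only [smul_eq_C_mul, smul_eq_mul]
  ring

theorem fieldOp_commutator (f g : V) :
    fieldOp b B ψ f * fieldOp b B ψ g - fieldOp b B ψ g * fieldOp b B ψ f =
      algebraMap ℂ _ (B f g - B g f) := by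
  refine LinearMap.ext fun q => ?_
  rw [LinearMap.sub_apply, Module.End.mul_apply, Module.End.mul_apply, Module.algebraMap_end_apply,
    fieldOp_apply b B ψ f (fieldOp b B ψ g q), fieldOp_apply b B ψ g (fieldOp b B ψ f q),
    annihilator_fieldOp, annihilator_fieldOp]
  simp only [fieldOp_apply, annihilator_comm b B f g, sub_smul]
  ring

/-- Evaluation in the vacuum of all modes but the classical one. -/
noncomputable def vacuumEval : MvPolynomial (Option ι) ℂ →ₐ[ℂ] Polynomial ℂ :=
  aeval fun o => o.elim Polynomial.X fun _ => 0

theorem vacuumEval_creator (f : V) : vacuumEval (creator b f) = 0 := by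
  have h : (vacuumEval (ι := ι)).toLinearMap ∘ₗ creator b = 0 := by
    refine b.ext fun i => ?_
    simp [creator, vacuumEval]
  exact LinearMap.congr_fun h f

theorem vacuumEval_pderiv_none (q : MvPolynomial (Option ι) ℂ) :
    vacuumEval (pderiv none q) = Polynomial.derivative (vacuumEval q) := by
  classical
  induction q using MvPolynomial.induction_on with
  | C a => simp [vacuumEval]
  | add p q hp hq => simp only [map_add, hp, hq]
  | mul_X p o hp =>
    rw [Derivation.leibniz, map_mul, Polynomial.derivative_mul, map_add, smul_eq_mul, smul_eq_mul,
      map_mul, map_mul, hp]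
    cases o <;> simp [vacuumEval, pderiv_X] <;> ring

theorem vacuumEval_fieldOp (f : V) (q : MvPolynomial (Option ι) ℂ) :
    vacuumEval (fieldOp b B ψ f q) =
      vacuumEval (annihilator b B f q) + ψ f • (Polynomial.X * vacuumEval q) := by
  rw [fieldOp_apply, map_add, map_mul, map_add, vacuumEval_creator, zero_add, map_smul,
    smul_mul_assoc, add_comm]
  congr 3
  simp [vacuumEval]

/-- The correlation functions of the representation for a functional of the classical variable. -/
noncomputable def correlator (L : Polynomial ℂ →ₗ[ℂ] ℂ) (l : List V) : ℂ :=
  L (vacuumEval (l.foldr (fun f q => fieldOp b B ψ f q) 1))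

/-- Freezing the classical variable at `x` turns it into the mean `x ψ(f)` and leaves the covariance
`B`. -/
theorem isWick_correlator_eval (x : ℂ) :
    IsWick (fun f g => B f g) (fun f => x * ψ f)
      (correlator b B ψ (Polynomial.leval x)) := by
  refine isWick_vacuum (fun f => fieldOp b B ψ f) (fun f => (annihilator b B f).toLinearMap) 1
    (Polynomial.leval x ∘ₗ vacuumEval.toLinearMap) _ _ (fun f q => ?_)
    (fun f g q => annihilator_fieldOp b B ψ f g q) (fun f => Derivation.map_one_eq_zero _) ?_
  · change (vacuumEval (fieldOp b B ψ f q)).eval x =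
      (vacuumEval (annihilator b B f q)).eval x + x * ψ f * (vacuumEval q).eval x
    rw [vacuumEval_fieldOp]
    simp
    ring
  · simp

/-- The integration by parts hypothesis on `L` trades multiplication by the classical variable for
its derivative. That variable then behaves like one more mode, adding `ψ f * ψ g` to the covariance
instead of a mean. -/
theorem isWick_correlator_gaussian (L : Polynomial ℂ →ₗ[ℂ] ℂ) (hL1 : L 1 = 1)
    (hL : ∀ q, L (Polynomial.X * q) = L (Polynomial.derivative q)) :
    IsWick (fun f g => B f g + ψ f * ψ g) (fun _ => 0) (correlator b B ψ L) := by
  refine isWick_vacuum (fun f => fieldOp b B ψ f)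
    (fun f => (annihilator b B f).toLinearMap + ψ f • (pderiv none).toLinearMap) 1
    (L ∘ₗ vacuumEval.toLinearMap) _ _ (fun f q => ?_) (fun f g q => ?_) (fun f => ?_) ?_
  · change L (vacuumEval (fieldOp b B ψ f q)) =
      L (vacuumEval (annihilator b B f q + ψ f • pderiv none q)) + 0 * _
    rw [vacuumEval_fieldOp, map_add, map_add, map_add, map_smul, map_smul, map_smul, hL,
      vacuumEval_pderiv_none]
    ring
  · change annihilator b B f (fieldOp b B ψ g q) + ψ f • pderiv none (fieldOp b B ψ g q) =
      fieldOp b B ψ g (annihilator b B f q + ψ f • pderiv none q) + _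
    rw [annihilator_fieldOp, pderiv_none_fieldOp, map_add, map_smul, smul_add, add_smul, mul_smul]
    abel
  · change annihilator b B f 1 + ψ f • pderiv none 1 = 0
    rw [Derivation.map_one_eq_zero, Derivation.map_one_eq_zero, smul_zero, add_zero]
  · simpa using hL1

end FockModel

end Fock

/-! ### Gaussian moments of a half-line -/

namespace HalfGaussian

open MeasureTheory Polynomial

/-- A polynomial times the Gaussian weight. -/
noncomputable def weighted (q : ℂ[X]) (x : ℝ) : ℂ :=
  q.eval (x : ℂ) * ((Real.exp (-(1 / 2) * x ^ 2) : ℝ) : ℂ)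

theorem integrable_weighted (q : ℂ[X]) : Integrable (weighted q) := by
  induction q using Polynomial.induction_on' with
  | add p q hp hq =>
    refine (hp.add hq).congr (Filter.Eventually.of_forall fun x => ?_)
    simp [weighted, add_mul]
  | monomial n a =>
    have h := (integrable_rpow_mul_exp_neg_mul_sq (b := 1 / 2) (by norm_num)
      (s := (n : ℝ)) (by have := n.cast_nonneg (α := ℝ); linarith)).ofReal (𝕜 := ℂ)
    refine (h.const_mul a).congr (Filter.Eventually.of_forall fun x => ?_)
    change a * ((x ^ (n : ℝ) * Real.exp (-(1 / 2) * x ^ 2) : ℝ) : ℂ) = _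
    rw [weighted, eval_monomial, Real.rpow_natCast, Complex.ofReal_mul, Complex.ofReal_pow]
    ring

theorem hasDerivAt_weighted (q : ℂ[X]) (x : ℝ) :
    HasDerivAt (weighted q) (weighted (derivative q - X * q) x) x := by
  have h1 : HasDerivAt (fun y : ℝ => q.eval (y : ℂ)) ((derivative q).eval (x : ℂ)) x :=
    (q.hasDerivAt (x : ℂ)).comp_ofReal
  have h2 : HasDerivAt (fun y : ℝ => Real.exp (-(1 / 2) * y ^ 2))
      (Real.exp (-(1 / 2) * x ^ 2) * (-(1 / 2) * (2 * x))) x := by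
    have := ((hasDerivAt_pow 2 x).const_mul (-(1 / 2 : ℝ))).exp
    simpa using this
  refine (h1.mul h2.ofReal_comp).congr_deriv ?_
  simp only [weighted, eval_sub, eval_mul, eval_X]
  push_cast
  ring

/-- The integrand is the derivative of `q(x) exp(-x²/2)`, which vanishes at infinity; only the
boundary term at `0` remains. -/
theorem integral_weighted (q : ℂ[X]) :
    ∫ x in Set.Ioi (0 : ℝ), weighted (derivative q - X * q) x = -q.eval 0 := by
  have h := integral_Ioi_of_hasDerivAt_of_tendsto' (a := 0) (fun x _ => hasDerivAt_weighted q x)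
    (integrable_weighted _).integrableOn
    (tendsto_zero_of_hasDerivAt_of_integrableOn_Ioi (a := 0) (fun x _ => hasDerivAt_weighted q x)
      (integrable_weighted _).integrableOn (integrable_weighted _).integrableOn)
  rw [h]
  simp [weighted]

/-- The normalization `∫₀^∞ exp(-x²/2) dx`. -/
noncomputable def mass : ℝ := ∫ x in Set.Ioi (0 : ℝ), Real.exp (-(1 / 2) * x ^ 2)

theorem mass_pos : 0 < mass := by
  rw [mass, integral_gaussian_Ioi]
  positivity

/-- The expectation of `q(c x)` in the half-line Gaussian distribution. -/
noncomputable def expectation (c : ℝ) : ℂ[X] →ₗ[ℂ] ℂ where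
  toFun q := (mass : ℂ)⁻¹ * ∫ x in Set.Ioi (0 : ℝ), weighted (q.comp (C (c : ℂ) * X)) x
  map_add' p q := by
    rw [← mul_add, ← integral_add (integrable_weighted _).integrableOn
      (integrable_weighted _).integrableOn]
    congr 2
    ext x
    simp [weighted, add_mul]
  map_smul' a q := by
    have h : ∀ x, weighted ((a • q).comp (C (c : ℂ) * X)) x =
        a * weighted (q.comp (C (c : ℂ) * X)) x := fun x => by simp [weighted, mul_assoc]
    simp only [h]
    rw [integral_const_mul, RingHom.id_apply, smul_eq_mul, mul_left_comm]

theorem expectation_apply (c : ℝ) (q : ℂ[X]) : expectation c q =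
    (mass : ℂ)⁻¹ * ∫ x in Set.Ioi (0 : ℝ), weighted (q.comp (C (c : ℂ) * X)) x := rfl

theorem expectation_one (c : ℝ) : expectation c 1 = 1 := by
  rw [expectation_apply]
  simp only [one_comp, weighted, eval_one, one_mul]
  rw [integral_complex_ofReal]
  exact inv_mul_cancel₀ (Complex.ofReal_ne_zero.mpr mass_pos.ne')

/-- On a half-line, Gaussian integration by parts fails by a boundary term odd in `c`. It cancels in
the average over `c = ±1`, yet it is what gives each half a nonzero mean. -/
theorem expectation_derivative_sub (c : ℝ) (hc : c * c = 1) (q : ℂ[X]) :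
    expectation c (derivative q) - expectation c (X * q) = -c * (mass : ℂ)⁻¹ * q.eval 0 := by
  have hcc : (c : ℂ) * c = 1 := by exact_mod_cast hc
  have h := integral_weighted (q.comp (C (c : ℂ) * X))
  have e : (derivative q - X * q).comp (C (c : ℂ) * X) =
      C (c : ℂ) * (derivative (q.comp (C (c : ℂ) * X)) - X * q.comp (C (c : ℂ) * X)) := by
    have hC : (C (c : ℂ)) * C (c : ℂ) = 1 := by rw [← C_mul, hcc, C_1]
    rw [derivative_comp, sub_comp, mul_comp, X_comp, derivative_mul, derivative_C, derivative_X]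
    linear_combination (-(derivative q).comp (C (c : ℂ) * X)) * hC
  rw [← map_sub, expectation_apply, e]
  have e2 : ∀ (r : ℂ[X]) (x : ℝ), weighted (C (c : ℂ) * r) x = c * weighted r x := fun r x => by
    simp [weighted, mul_assoc]
  simp only [e2]
  rw [integral_const_mul, h, eval_comp, eval_mul, eval_X, mul_zero]
  ring

/-- The expectation in the Gaussian distribution on the line. -/
noncomputable def symmetricExpectation : ℂ[X] →ₗ[ℂ] ℂ :=
  (1 / 2 : ℂ) • (expectation 1 + expectation (-1))

theorem symmetricExpectation_one : symmetricExpectation 1 = 1 := by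
  simp only [symmetricExpectation, LinearMap.smul_apply, LinearMap.add_apply, expectation_one]
  norm_num

theorem symmetricExpectation_X_mul (q : ℂ[X]) :
    symmetricExpectation (X * q) = symmetricExpectation (derivative q) := by
  have h1 := expectation_derivative_sub 1 (by norm_num) q
  have h2 := expectation_derivative_sub (-1) (by norm_num) q
  simp only [symmetricExpectation, LinearMap.smul_apply, LinearMap.add_apply, smul_eq_mul]
  push_cast at h1 h2
  linear_combination (-1 / 2) * (h1 + h2)

theorem expectation_one_X_ne_zero : expectation 1 X ≠ 0 := by
  have h := expectation_derivative_sub 1 (by norm_num) 1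
  rw [derivative_one, map_zero, mul_one, eval_one] at h
  intro h0
  rw [h0] at h
  have := mass_pos.ne'
  simp [this] at h

theorem expectation_nonneg (c : ℝ) (q : ℂ[X]) (hq : ∀ x : ℝ, 0 ≤ q.eval (x : ℂ)) :
    0 ≤ expectation c q := by
  have h : ∀ x : ℝ, weighted (q.comp (C (c : ℂ) * X)) x =
      (((q.eval ((c * x : ℝ) : ℂ)).re * Real.exp (-(1 / 2) * x ^ 2) : ℝ) : ℂ) := by
    intro x
    have h1 := Complex.le_def.mp (hq (c * x))
    rw [weighted, eval_comp, eval_mul, eval_C, eval_X, Complex.ofReal_mul, ← Complex.ofReal_mul c x]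
    congr 1
    exact Complex.ext rfl h1.2.symm
  rw [expectation_apply]
  simp only [h]
  rw [integral_complex_ofReal, ← Complex.ofReal_inv, ← Complex.ofReal_mul]
  refine Complex.zero_le_real.mpr (mul_nonneg (inv_nonneg.mpr mass_pos.le)
    (integral_nonneg fun x => mul_nonneg ?_ (Real.exp_pos _).le))
  exact (Complex.le_def.mp (hq (c * x))).1

end HalfGaussian

/-! ### The Bargmann inner product -/

namespace Bargmann

open MvPolynomial
open scoped Nat

variable {σ : Type*} [Fintype σ]

/-- The factorial of a multi-index. -/
noncomputable def multiFactorial (m : σ →₀ ℕ) : ℂ := ∏ i, ((m i)! : ℂ)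

theorem multiFactorial_add_single (m : σ →₀ ℕ) (r : σ) :
    multiFactorial (m + Finsupp.single r 1) = (m r + 1) * multiFactorial m := by
  classical
  rw [multiFactorial, multiFactorial, Fintype.prod_eq_mul_prod_compl r,
    Fintype.prod_eq_mul_prod_compl r fun i => ((m i)! : ℂ), ← mul_assoc]
  congr 1
  · simp [Nat.factorial_succ]
  · refine Finset.prod_congr rfl fun i hi => ?_
    have : i ≠ r := by simpa using hi
    simp [Finsupp.single_eq_of_ne this]

/-- The Bargmann pairing on polynomials. -/
noncomputable def pairing (p q : MvPolynomial σ ℂ) : ℂ :=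
  ∑ m ∈ p.support, (starRingEnd ℂ) (p.coeff m) * multiFactorial m * q.coeff m

theorem pairing_eq_sum (p q : MvPolynomial σ ℂ) (s : Finset (σ →₀ ℕ)) (hs : p.support ⊆ s) :
    pairing p q = ∑ m ∈ s, (starRingEnd ℂ) (p.coeff m) * multiFactorial m * q.coeff m := by
  refine Finset.sum_subset hs fun m _ hm => ?_
  rw [notMem_support_iff.mp hm]
  simp

theorem pairing_add_left (p p' q : MvPolynomial σ ℂ) :
    pairing (p + p') q = pairing p q + pairing p' q := by
  classical
  rw [pairing_eq_sum _ q _ support_add, pairing_eq_sum p q _ Finset.subset_union_left,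
    pairing_eq_sum p' q _ Finset.subset_union_right, ← Finset.sum_add_distrib]
  refine Finset.sum_congr rfl fun m _ => ?_
  rw [coeff_add, map_add]
  ring

theorem pairing_smul_left (c : ℂ) (p q : MvPolynomial σ ℂ) :
    pairing (c • p) q = (starRingEnd ℂ) c * pairing p q := by
  rw [pairing_eq_sum _ q p.support support_smul, pairing, Finset.mul_sum]
  refine Finset.sum_congr rfl fun m _ => ?_
  rw [coeff_smul, smul_eq_mul, map_mul]
  ring

theorem pairing_conj (p q : MvPolynomial σ ℂ) :
    (starRingEnd ℂ) (pairing p q) = pairing q p := by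
  classical
  rw [pairing_eq_sum p q (p.support ∪ q.support) Finset.subset_union_left,
    pairing_eq_sum q p (p.support ∪ q.support) Finset.subset_union_right, map_sum]
  refine Finset.sum_congr rfl fun m _ => ?_
  rw [map_mul, map_mul, Complex.conj_conj]
  have : (starRingEnd ℂ) (multiFactorial m) = multiFactorial m := by simp [multiFactorial]
  rw [this]
  ring

/-- The Bargmann pairing as a sesquilinear form. -/
noncomputable def form : MvPolynomial σ ℂ →ₗ⋆[ℂ] MvPolynomial σ ℂ →ₗ[ℂ] ℂ :=
  LinearMap.mk₂'ₛₗ (starRingEnd ℂ) (RingHom.id ℂ) pairing pairing_add_left pairing_smul_left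
    (fun p q q' => by
      rw [← pairing_conj, pairing_add_left, map_add, pairing_conj, pairing_conj])
    (fun c p q => by
      rw [← pairing_conj, pairing_smul_left, map_mul, Complex.conj_conj, pairing_conj]; rfl)

theorem form_apply (p q : MvPolynomial σ ℂ) : form p q = pairing p q := rfl

theorem form_conj (p q : MvPolynomial σ ℂ) : (starRingEnd ℂ) (form p q) = form q p :=
  pairing_conj p q

theorem form_self_nonneg (p : MvPolynomial σ ℂ) : 0 ≤ form p p := by
  rw [form_apply, pairing]
  refine Finset.sum_nonneg fun m _ => ?_
  have h : (starRingEnd ℂ) (p.coeff m) * multiFactorial m * p.coeff m =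
      ((Complex.normSq (p.coeff m) * ∏ i, ((m i)! : ℝ) : ℝ) : ℂ) := by
    rw [mul_right_comm, ← Complex.normSq_eq_conj_mul_self, multiFactorial]
    push_cast
    ring
  rw [h]
  exact Complex.zero_le_real.mpr (mul_nonneg (Complex.normSq_nonneg _) (by positivity))

theorem form_monomial (m : σ →₀ ℕ) (a : ℂ) (q : MvPolynomial σ ℂ) :
    form (monomial m a) q = (starRingEnd ℂ) a * multiFactorial m * q.coeff m := by
  classical
  rw [form_apply, pairing_eq_sum _ q {m} support_monomial_subset, Finset.sum_singleton,
    coeff_monomial, if_pos rfl]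

theorem form_one (q : MvPolynomial σ ℂ) : form 1 q = constantCoeff q := by
  rw [← C_1, ← monomial_zero', form_monomial]
  simp [multiFactorial, constantCoeff_eq]

/-- The factorial weights are chosen for this: raising the exponent of `X r` multiplies the weight
by `m r + 1`, the factor produced by the derivative. -/
theorem form_X_mul (r : σ) (p q : MvPolynomial σ ℂ) :
    form (X r * p) q = form p (pderiv r q) := by
  induction p using MvPolynomial.induction_on' with
  | monomial m a =>
    rw [X, monomial_mul, one_mul, form_monomial, form_monomial, coeff_pderiv,
      add_comm (Finsupp.single r 1), multiFactorial_add_single]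
    ring
  | add p p' hp hp' => rw [mul_add, map_add, LinearMap.add_apply, hp, hp', map_add,
      LinearMap.add_apply]

theorem form_pderiv (r : σ) (p q : MvPolynomial σ ℂ) :
    form (pderiv r p) q = form p (X r * q) := by
  rw [← form_conj, ← form_X_mul, form_conj]

variable {V : Type*} [AddCommGroup V] [Module ℂ V] [StarAddMonoid V]

/-- The annihilation operator of a test function with mode coefficients `v r`. -/
noncomputable def annihilator (v : σ → V →ₗ[ℂ] ℂ) (f : V) :
    MvPolynomial σ ℂ →ₗ[ℂ] MvPolynomial σ ℂ :=
  ∑ r, (starRingEnd ℂ) (v r (star f)) • (pderiv r).toLinearMap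

/-- The field operator of a test function with mode coefficients `v r` and mean `s`. -/
noncomputable def fieldOp (v : σ → V →ₗ[ℂ] ℂ) (s : V → ℂ) (f : V) :
    MvPolynomial σ ℂ →ₗ[ℂ] MvPolynomial σ ℂ :=
  LinearMap.mulLeft ℂ (∑ r, v r f • X r) + annihilator v f + s f • LinearMap.id

theorem annihilator_apply (v : σ → V →ₗ[ℂ] ℂ) (f : V) (q : MvPolynomial σ ℂ) :
    annihilator v f q = ∑ r, (starRingEnd ℂ) (v r (star f)) • pderiv r q := by
  rw [annihilator, LinearMap.sum_apply]
  rfl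

theorem fieldOp_apply (v : σ → V →ₗ[ℂ] ℂ) (s : V → ℂ) (f : V) (q : MvPolynomial σ ℂ) :
    fieldOp v s f q = ∑ r, v r f • (X r * q) + annihilator v f q + s f • q := by
  rw [fieldOp]
  simp [Finset.sum_mul]

/-- The conjugated coefficients `v r (star f)` in the annihilator are exactly those that make
creation for `f` adjoint to annihilation for `star f`; the scalar part needs the mean to be real. -/
theorem form_fieldOp (v : σ → V →ₗ[ℂ] ℂ) (s : V → ℂ)
    (hs : ∀ f, s (star f) = (starRingEnd ℂ) (s f)) (f : V) (p q : MvPolynomial σ ℂ) :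
    form (fieldOp v s f p) q = form p (fieldOp v s (star f) q) := by
  simp only [fieldOp_apply, annihilator_apply, map_add, map_sum, LinearMap.add_apply,
    LinearMap.sum_apply, LinearMap.map_smulₛₗ, LinearMap.smul_apply, form_X_mul, form_pderiv,
    star_star, hs, RingHom.id_apply, Complex.conj_conj]
  ring

omit [Fintype σ] in
theorem pderiv_comm (r t : σ) (q : MvPolynomial σ ℂ) :
    pderiv r (pderiv t q) = pderiv t (pderiv r q) := by
  classical
  have h : ⁅(pderiv r : Derivation ℂ (MvPolynomial σ ℂ) (MvPolynomial σ ℂ)),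
      (pderiv t : Derivation ℂ (MvPolynomial σ ℂ) (MvPolynomial σ ℂ))⁆ = 0 := by
    refine derivation_ext fun o => ?_
    rw [Derivation.commutator_apply, pderiv_X, pderiv_X, Pi.single_apply, Pi.single_apply]
    split_ifs <;> simp
  have h2 := congrArg (fun D => D q) h
  simp only [Derivation.commutator_apply, Derivation.zero_apply] at h2
  exact sub_eq_zero.mp h2

theorem annihilator_comm (v : σ → V →ₗ[ℂ] ℂ) (f g : V) (q : MvPolynomial σ ℂ) :
    annihilator v f (annihilator v g q) = annihilator v g (annihilator v f q) := by
  have h : ∀ r t : σ, Commute (S := Module.End ℂ (MvPolynomial σ ℂ))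
      (pderiv (R := ℂ) r).toLinearMap (pderiv (R := ℂ) t).toLinearMap := fun r t => LinearMap.ext (pderiv_comm r t)
  have h2 : Commute (annihilator v f : Module.End ℂ (MvPolynomial σ ℂ)) (annihilator v g) :=
    Commute.sum_left _ _ _ fun r _ => Commute.sum_right _ _ _ fun t _ =>
      ((h r t).smul_left _).smul_right _
  exact LinearMap.congr_fun h2 q

theorem annihilator_X_mul (v : σ → V →ₗ[ℂ] ℂ) (f : V) (r : σ) (q : MvPolynomial σ ℂ) :
    annihilator v f (X r * q) =
      X r * annihilator v f q + (starRingEnd ℂ) (v r (star f)) • q := by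
  classical
  have h : ∀ t, (starRingEnd ℂ) (v t (star f)) • pderiv t (X r * q) =
      X r * ((starRingEnd ℂ) (v t (star f)) • pderiv t q) +
        (if t = r then (starRingEnd ℂ) (v t (star f)) • q else 0) := by
    intro t
    rw [Derivation.leibniz, pderiv_X, Pi.single_apply, smul_eq_mul, smul_eq_mul, smul_add,
      mul_smul_comm]
    by_cases h : t = r
    · subst h; simp
    · simp [h, Ne.symm h]
  rw [annihilator_apply, annihilator_apply, Finset.sum_congr rfl fun t _ => h t,
    Finset.sum_add_distrib, Finset.mul_sum, Finset.sum_ite_eq' Finset.univ r]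
  simp

theorem annihilator_fieldOp (v : σ → V →ₗ[ℂ] ℂ) (s : V → ℂ) (f g : V) (q : MvPolynomial σ ℂ) :
    annihilator v f (fieldOp v s g q) = fieldOp v s g (annihilator v f q) +
      (∑ r, (starRingEnd ℂ) (v r (star f)) * v r g) • q := by
  have h2 : annihilator v f (∑ r, v r g • (X r * q)) = ∑ r, v r g • (X r * annihilator v f q) +
      (∑ r, (starRingEnd ℂ) (v r (star f)) * v r g) • q := by
    rw [map_sum, Finset.sum_smul, ← Finset.sum_add_distrib]
    refine Finset.sum_congr rfl fun r _ => ?_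
    rw [LinearMap.map_smul, annihilator_X_mul, smul_add, smul_smul, mul_comm (v r g)]
  rw [fieldOp_apply, fieldOp_apply, map_add, map_add, LinearMap.map_smul, annihilator_comm, h2]
  abel

theorem isWick_fieldOp (v : σ → V →ₗ[ℂ] ℂ) (s : V → ℂ) :
    IsWick (fun f g => ∑ r, (starRingEnd ℂ) (v r (star f)) * v r g) s
      fun l : List V => form 1 (l.foldr (fun f q => fieldOp v s f q) 1) := by
  refine isWick_vacuum (fieldOp v s) (annihilator v) 1 (form 1) _ _ (fun f q => ?_)
    (annihilator_fieldOp v s) (fun f => ?_) ?_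
  · simp [fieldOp_apply, form_one]
  · simp [annihilator_apply]
  · simp [form_one]

/-- Moving the operators of the left word across one at a time stars and reverses them, so the
correlators of `star a * a` become Gram matrix entries. -/
theorem form_foldr (v : σ → V →ₗ[ℂ] ℂ) (s : V → ℂ)
    (hs : ∀ f, s (star f) = (starRingEnd ℂ) (s f)) (l l' : List V) :
    form (l.foldr (fun f q => fieldOp v s f q) 1) (l'.foldr (fun f q => fieldOp v s f q) 1) =
      form 1 (((l.map star).reverse ++ l').foldr (fun f q => fieldOp v s f q) 1) := by
  induction l generalizing l' with
  | nil => rfl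
  | cons f l ih =>
    rw [List.foldr_cons, form_fieldOp v s hs]
    have := ih (star f :: l')
    rw [List.foldr_cons] at this
    rw [this, List.map_cons, List.reverse_cons, List.append_assoc, List.singleton_append]

end Bargmann

/-- Gaussian functionals whose two-point function is positive are positive. -/
theorem IsWick.nonneg {V H : Type*} [AddCommGroup V] [Module ℂ V] [StarAddMonoid V]
    [NormedAddCommGroup H] [InnerProductSpace ℂ H] (k : V →ₗ[ℂ] H) {s : V → ℂ}
    (hs : ∀ f, s (star f) = (starRingEnd ℂ) (s f)) {G : List V → ℂ}
    (hG : IsWick (fun f g => ⟪k (star f), k g⟫_ℂ) s G) (c : List V →₀ ℂ) :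
    0 ≤ c.sum fun l a => c.sum fun l' a' =>
      (starRingEnd ℂ) a * a' * G ((l.map star).reverse ++ l') := by
  classical
  let U₀ : Finset V := c.support.biUnion fun l => l.toFinset
  -- The set is closed under `star` because correlators of `star a * a` involve the starred letters
  -- as well.
  let U : Finset V := U₀ ∪ U₀.image star
  have hUstar : ∀ f ∈ U, star f ∈ U := by
    intro f hf
    rcases Finset.mem_union.mp hf with h | h
    · exact Finset.mem_union_right _ (Finset.mem_image_of_mem _ h)
    · obtain ⟨g, hg, rfl⟩ := Finset.mem_image.mp h
      rw [star_star]
      exact Finset.mem_union_left _ hg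
  have hU : ∀ l ∈ c.support, ∀ f ∈ l, f ∈ U := fun l hl f hf =>
    Finset.mem_union_left _ (Finset.mem_biUnion.mpr ⟨l, hl, List.mem_toFinset.mpr hf⟩)
  let E : Submodule ℂ H := Submodule.span ℂ (U.image k : Set H)
  have hkE : ∀ f ∈ U, k f ∈ E := fun f hf =>
    Submodule.subset_span (Finset.mem_coe.mpr (Finset.mem_image_of_mem k hf))
  -- Coordinates in this basis provide finitely many Bargmann modes. By Parseval in `E` they
  -- reproduce the covariance on `U`, which is all that the correlators in question depend on.
  let e := stdOrthonormalBasis ℂ E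
  let v : Fin (Module.finrank ℂ E) → V →ₗ[ℂ] ℂ := fun r => (innerₛₗ ℂ (e r : H)) ∘ₗ k
  have hv : ∀ f ∈ (U : Set V), ∀ g ∈ (U : Set V),
      ⟪k (star f), k g⟫_ℂ = ∑ r, (starRingEnd ℂ) (v r (star f)) * v r g := by
    intro f hf g hg
    have h := e.sum_inner_mul_inner ⟨k (star f), hkE _ (hUstar f hf)⟩ ⟨k g, hkE g hg⟩
    refine Eq.trans ?_ (Eq.trans h.symm (Finset.sum_congr rfl fun r _ => ?_))
    · rfl
    · rw [← inner_conj_symm]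
      rfl
  have hG2 : ∀ l ∈ c.support, ∀ l' ∈ c.support, G ((l.map star).reverse ++ l') =
      Bargmann.form (l.foldr (fun f q => Bargmann.fieldOp v s f q) 1)
        (l'.foldr (fun f q => Bargmann.fieldOp v s f q) 1) := by
    intro l hl l' hl'
    rw [Bargmann.form_foldr v s hs]
    refine hG.eq_of_eqOn (Bargmann.isWick_fieldOp v s) U hv _ fun f hf => ?_
    rcases List.mem_append.mp hf with h | h
    · rw [List.mem_reverse, List.mem_map] at h
      obtain ⟨g, hg, rfl⟩ := h
      exact hUstar g (hU l hl g hg)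
    · exact hU l' hl' f h
  have h := Bargmann.form_self_nonneg
    (∑ l ∈ c.support, c l • l.foldr (fun f q => Bargmann.fieldOp v s f q) 1)
  convert h using 1
  simp only [map_sum, LinearMap.sum_apply, LinearMap.map_smulₛₗ, LinearMap.smul_apply,
    Finsupp.sum, RingHom.id_apply, smul_eq_mul, Finset.mul_sum]
  rw [Finset.sum_comm]
  refine Finset.sum_congr rfl fun l hl => Finset.sum_congr rfl fun l' hl' => ?_
  rw [hG2 _ (by assumption) _ (by assumption)]
  ring

/-! ### Complex conjugation and the structure operators on the phase space -/

section PhaseSpace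

variable {V : Type*} [AddCommGroup V] [Module ℂ V] [StarAddMonoid V] [StarModule ℂ V]

namespace FieldState

variable {Ω : CommutatorForm V} (ω : FieldState Ω)

theorem muForm_star_star (f g : V) :
    ω.muForm (star f) (star g) = ω.muForm g f := by
  rw [ω.muForm_eq, ω.muForm_eq, star_star, star_star, add_comm]

theorem muForm_conj (f g : V) : (starRingEnd ℂ) (ω.muForm f g) = ω.muForm g f :=
  (coreOfForm ω.muForm ω.muForm_nonneg).conj_inner_symm g f

theorem halfForm_conj (f g : V) : (starRingEnd ℂ) (Ω.halfForm f g) = -Ω.halfForm g f := by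
  simp only [CommutatorForm.halfForm, LinearMap.mk₂'ₛₗ_apply, map_mul]
  rw [← Ω.real, star_star, Ω.antisymm f (star g), show (1 / 2 : ℂ) = ((1 / 2 : ℝ) : ℂ) by norm_num,
    Complex.conj_ofReal]
  ring

theorem halfForm_star (f g : V) :
    Ω.halfForm f (star g) = (starRingEnd ℂ) (Ω.halfForm (star f) g) := by
  simp only [CommutatorForm.halfForm, LinearMap.mk₂'ₛₗ_apply, map_mul]
  rw [← Ω.real, star_star, show (1 / 2 : ℂ) = ((1 / 2 : ℝ) : ℂ) by norm_num, Complex.conj_ofReal]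

theorem norm_ket_star (f : V) : ‖ω.ket (star f)‖ = ‖ω.ket f‖ := by
  rw [norm_ket, norm_ket, muForm_star_star]

/-- The map `f ↦ |star f⟩`. -/
noncomputable def starKet : V →ₗ⋆[ℂ] ω.K where
  toFun f := ω.ket (star f)
  map_add' f g := by rw [star_add, map_add]
  map_smul' c f := by rw [star_smul, map_smul]; rfl

theorem norm_starKet_le (f : V) : ‖ω.starKet f‖ ≤ 1 * ‖ω.ket f‖ := by
  rw [one_mul]
  exact (ω.norm_ket_star f).le

/-- Complex conjugation on `K_μ`. -/
noncomputable def conjugation : ω.K →SL[starRingEnd ℂ] ω.K := ω.starKet.extendOfNorm ω.ket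

theorem conjugation_ket (f : V) : ω.conjugation (ω.ket f) = ω.ket (star f) :=
  LinearMap.extendOfNorm_eq ω.denseRange_ket ⟨1, ω.norm_starKet_le⟩ f

theorem conjugation_conjugation (x : ω.K) : ω.conjugation (ω.conjugation x) = x := by
  refine isClosed_property ω.denseRange_ket
    (p := fun x => ω.conjugation (ω.conjugation x) = x) (isClosed_eq (by fun_prop) continuous_id)
    (fun f => ?_) x
  rw [conjugation_ket, conjugation_ket, star_star]

theorem inner_conjugation (x y : ω.K) : ⟪ω.conjugation x, ω.conjugation y⟫_ℂ = ⟪y, x⟫_ℂ := by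
  refine isClosed_property ω.denseRange_ket (p := fun x =>
    ⟪ω.conjugation x, ω.conjugation y⟫_ℂ = ⟪y, x⟫_ℂ) (isClosed_eq (by fun_prop) (by fun_prop))
    (fun f => ?_) x
  refine isClosed_property ω.denseRange_ket (p := fun y =>
    ⟪ω.conjugation (ω.ket f), ω.conjugation y⟫_ℂ = ⟪y, ω.ket f⟫_ℂ)
    (isClosed_eq (by fun_prop) (by fun_prop)) (fun g => ?_) y
  rw [conjugation_ket, conjugation_ket, inner_ket, inner_ket, muForm_star_star]

theorem operator_ext {S T : ω.K →L[ℂ] ω.K}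
    (h : ∀ f g, ⟪ω.ket f, S (ω.ket g)⟫_ℂ = ⟪ω.ket f, T (ω.ket g)⟫_ℂ) : S = T :=
  DFunLike.coe_injective (ω.denseRange_ket.equalizer S.continuous T.continuous
    (funext fun g => ω.denseRange_ket.eq_of_inner_right ℂ fun f => h f g))

theorem operator_nonneg {T : ω.K →L[ℂ] ω.K} (h : ∀ f, 0 ≤ ⟪ω.ket f, T (ω.ket f)⟫_ℂ) : 0 ≤ T := by
  rw [ContinuousLinearMap.nonneg_iff_isPositive, ContinuousLinearMap.isPositive_iff_complex]
  intro x
  have hx := Complex.le_def.mp (isClosed_property ω.denseRange_ket (p := fun x => 0 ≤ ⟪x, T x⟫_ℂ)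
      (isClosed_le continuous_const (by fun_prop)) h x)
  have hs : ⟪T x, x⟫_ℂ = ⟪x, T x⟫_ℂ := by
    rw [← inner_conj_symm, Complex.conj_eq_iff_im.mpr hx.2.symm]
  rw [hs]
  exact ⟨Complex.ext rfl hx.2, hx.1⟩

/-- The hypothesis on `B` is the reality of the form; tested on the dense set of kets it says that
`T` commutes with the antiunitary conjugation. -/
theorem operator_conjugation {T : ω.K →L[ℂ] ω.K} {B : V → V → ℂ}
    (hT : ∀ f g, ⟪ω.ket f, T (ω.ket g)⟫_ℂ = B f g)
    (hB : ∀ f g, B f (star g) = (starRingEnd ℂ) (B (star f) g)) (x : ω.K) :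
    T (ω.conjugation x) = ω.conjugation (T x) := by
  refine isClosed_property ω.denseRange_ket
    (p := fun x => T (ω.conjugation x) = ω.conjugation (T x))
    (isClosed_eq (by fun_prop) (by fun_prop)) (fun g => ω.denseRange_ket.eq_of_inner_right ℂ fun f => ?_) x
  have h : ω.ket f = ω.conjugation (ω.ket (star f)) := by rw [conjugation_ket, star_star]
  rw [conjugation_ket, hT, hB, ← hT]
  conv_rhs => rw [h, inner_conjugation]
  rw [inner_conj_symm]

theorem inner_R (f g : V) : ⟪ω.ket f, ω.R (ω.ket g)⟫_ℂ = Ω.halfForm f g :=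
  ω.inner_operator _ ω.halfForm_bounded f g

theorem R_conjugation (x : ω.K) : ω.R (ω.conjugation x) = ω.conjugation (ω.R x) :=
  ω.operator_conjugation ω.inner_R halfForm_star x

theorem star_R : star ω.R = -ω.R := by
  refine ω.operator_ext fun f g => ?_
  rw [ContinuousLinearMap.star_eq_adjoint, ContinuousLinearMap.adjoint_inner_right,
    ← inner_conj_symm, inner_R, halfForm_conj, _root_.neg_apply, inner_neg_right, inner_R]

variable {ω} {ω₂ : FieldState Ω} (h : MuDominated ω₂ ω)

theorem inner_Q (f g : V) : ⟪ω.ket f, Q h (ω.ket g)⟫_ℂ = ω₂.muForm f g :=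
  ω.inner_operator _ h.muForm_bounded f g

theorem inner_X (f g : V) : ⟪ω.ket f, X h (ω.ket g)⟫_ℂ = ω₂.twoPointForm f g :=
  ω.inner_operator _ h.twoPointForm_bounded f g

theorem Q_conjugation (x : ω.K) : Q h (ω.conjugation x) = ω.conjugation (Q h x) :=
  ω.operator_conjugation (inner_Q h) (fun f g => by
    rw [muForm_conj, ← muForm_star_star, star_star]) x

theorem X_eq : X h = Q h - I • ω.R := by
  refine ω.operator_ext fun f g => ?_
  rw [inner_X, _root_.sub_apply, inner_sub_right, inner_Q, _root_.smul_apply,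
    inner_smul_right, inner_R, twoPoint_eq]

/-- `Q + i R` implements the two-point function of `ω₂` with its arguments starred and exchanged.
Together with `X h = Q - i R` this gives the two-sided bound on which the comparison rests. -/
theorem Q_add_nonneg : 0 ≤ Q h + I • ω.R := by
  refine ω.operator_nonneg fun f => ?_
  rw [_root_.add_apply, inner_add_right, inner_Q, _root_.smul_apply,
    inner_smul_right, inner_R, ← twoPoint_swap]
  exact ω₂.twoPoint_nonneg _

theorem Q_refl : Q (MuDominated.refl ω) = 1 := by
  refine ω.operator_ext fun f g => ?_
  rw [inner_Q, one_apply_eq_self, inner_ket]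

end FieldState

end PhaseSpace

/-! ### Decomposition of Gaussian states -/

section Decomposition

variable {V : Type*} [AddCommGroup V] [Module ℂ V] [StarAddMonoid V] [StarModule ℂ V]
  {Ω : CommutatorForm V}

/-- The product of fields along a list of test functions. -/
noncomputable def CommutatorForm.word (Ω : CommutatorForm V) (l : List V) : FreeFieldAlgebra Ω :=
  (l.map Ω.field).prod

theorem CommutatorForm.star_word (l : List V) :
    star (Ω.word l) = Ω.word (l.map star).reverse := by
  induction l with
  | nil => simp [word]
  | cons f l ih =>
    simp only [word, List.map_cons, List.prod_cons, star_mul, List.reverse_cons, List.map_append,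
      List.prod_append, List.map_nil, List.prod_nil, mul_one, Ω.star_field] at ih ⊢
    rw [ih]

theorem CommutatorForm.span_word : Submodule.span ℂ (Set.range Ω.word) = ⊤ := by
  rw [eq_top_iff]
  rintro a -
  obtain ⟨t, rfl⟩ := RingQuot.mkAlgHom_surjective ℂ Ω.Rel a
  induction t using TensorAlgebra.induction with
  | algebraMap c =>
    rw [AlgHom.commutes, Algebra.algebraMap_eq_smul_one]
    exact Submodule.smul_mem _ _ (Submodule.subset_span ⟨[], by simp [word]⟩)
  | ι f => exact Submodule.subset_span ⟨[f], by simp [word]; rfl⟩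
  | mul x y hx hy =>
    rw [map_mul]
    have h := Submodule.mul_mem_mul hx hy
    rw [Submodule.span_mul_span] at h
    refine Submodule.span_mono ?_ h
    rintro _ ⟨_, ⟨l, rfl⟩, _, ⟨l', rfl⟩, rfl⟩
    exact ⟨l ++ l', by simp [word]⟩
  | add x y hx hy =>
    rw [map_add]
    exact Submodule.add_mem _ hx hy

section Representation

variable {ι : Type*} (b : Module.Basis ι ℂ V) (B : V →ₗ[ℂ] V →ₗ[ℂ] ℂ) (ψ : V →ₗ[ℂ] ℂ)
  (hB : ∀ f g, B f g - B g f = -I * Ω.form f g)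

/-- The representation of the free field algebra on the Fock model. -/
noncomputable def FockModel.rep :
    FreeFieldAlgebra Ω →ₐ[ℂ] Module.End ℂ (MvPolynomial (Option ι) ℂ) :=
  RingQuot.liftAlgHom ℂ ⟨TensorAlgebra.lift ℂ (fieldOp b B ψ), by
    rintro _ _ ⟨f, g⟩
    rw [map_sub, map_mul, map_mul, AlgHom.commutes, TensorAlgebra.lift_ι_apply,
      TensorAlgebra.lift_ι_apply, fieldOp_commutator, hB]⟩

theorem FockModel.rep_field (f : V) : rep b B ψ hB (Ω.field f) = fieldOp b B ψ f := by
  change rep b B ψ hB (RingQuot.mkAlgHom ℂ Ω.Rel (TensorAlgebra.ι ℂ f)) = _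
  rw [rep, RingQuot.liftAlgHom_mkAlgHom_apply, TensorAlgebra.lift_ι_apply]

theorem FockModel.rep_word (l : List V) (q : MvPolynomial (Option ι) ℂ) :
    rep b B ψ hB (Ω.word l) q = l.foldr (fun f q => fieldOp b B ψ f q) q := by
  induction l with
  | nil => simp [CommutatorForm.word]
  | cons f l ih =>
    rw [List.foldr_cons, ← ih, ← rep_field b B ψ hB, ← Module.End.mul_apply, ← map_mul]
    simp [CommutatorForm.word]

/-- The functional on the free field algebra obtained from a functional of the classical
variable. -/
noncomputable def FockModel.functional (L : Polynomial ℂ →ₗ[ℂ] ℂ) : FreeFieldAlgebra Ω →ₗ[ℂ] ℂ :=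
  L ∘ₗ vacuumEval.toLinearMap ∘ₗ LinearMap.applyₗ 1 ∘ₗ (rep b B ψ hB).toLinearMap

theorem FockModel.functional_apply (L : Polynomial ℂ →ₗ[ℂ] ℂ) (a : FreeFieldAlgebra Ω) :
    functional b B ψ hB L a = L (vacuumEval (rep b B ψ hB a 1)) := rfl

theorem FockModel.functional_word (L : Polynomial ℂ →ₗ[ℂ] ℂ) (l : List V) :
    functional b B ψ hB L (Ω.word l) = correlator b B ψ L l := by
  rw [functional_apply, rep_word]
  rfl

/-- Words span the algebra, so `star a * a` expands into the double sum of `IsWick.nonneg`. A real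
value `x` and a real `ψ` make the mean `x ψ` real. -/
theorem FockModel.functional_eval_nonneg {H : Type*} [NormedAddCommGroup H]
    [InnerProductSpace ℂ H] (k : V →ₗ[ℂ] H) (hk : ∀ f g, B f g = ⟪k (star f), k g⟫_ℂ)
    (hψ : ∀ f, ψ (star f) = (starRingEnd ℂ) (ψ f)) (x : ℝ) (a : FreeFieldAlgebra Ω) :
    0 ≤ functional b B ψ hB (Polynomial.leval (x : ℂ)) (star a * a) := by
  have ha : a ∈ Submodule.span ℂ (Set.range Ω.word) := by
    rw [CommutatorForm.span_word]
    trivial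
  obtain ⟨c, rfl⟩ := Finsupp.mem_span_range_iff_exists_finsupp.mp ha
  have hW := isWick_correlator_eval b B ψ (x : ℂ)
  simp only [hk] at hW
  have h := IsWick.nonneg k (fun f => by rw [hψ, map_mul, Complex.conj_ofReal]) hW c
  convert h using 1
  simp only [Finsupp.sum, star_sum, Finset.sum_mul, Finset.mul_sum, map_sum, star_smul,
    CommutatorForm.star_word, smul_mul_smul_comm, map_smul]
  rw [Finset.sum_comm]
  refine Finset.sum_congr rfl fun l _ => Finset.sum_congr rfl fun l' _ => ?_
  rw [smul_eq_mul, ← functional_word b B ψ hB]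
  simp [CommutatorForm.word]

end Representation

namespace FieldState

/-- A Gaussian state whose two-point function dominates the square of a real functional is a
mixture of Gaussian states, hence not pure. -/
theorem IsZeroMeanGaussian.not_isPure {ω : FieldState Ω} (hω : ω.IsZeroMeanGaussian)
    {H : Type*} [NormedAddCommGroup H] [InnerProductSpace ℂ H] (k : V →ₗ[ℂ] H) (ψ : V →ₗ[ℂ] ℂ)
    (hψ : ∀ f, ψ (star f) = (starRingEnd ℂ) (ψ f)) (hψ0 : ψ ≠ 0)
    (hW : ∀ f g, ω.twoPointForm f g = ⟪k f, k g⟫_ℂ + (starRingEnd ℂ) (ψ f) * ψ g) :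
    ¬ ω.IsPure := by
  let B : V →ₗ[ℂ] V →ₗ[ℂ] ℂ := LinearMap.mk₂ ℂ (fun f g => ⟪k (star f), k g⟫_ℂ)
    (fun f f' g => by rw [star_add, map_add, inner_add_left])
    (fun c f g => by
      rw [star_smul, map_smul, inner_smul_left, ← starRingEnd_apply, Complex.conj_conj,
        smul_eq_mul])
    (fun f g g' => by rw [map_add, inner_add_right])
    (fun c f g => by rw [map_smul, inner_smul_right, smul_eq_mul])
  have hBk : ∀ f g, B f g = ⟪k (star f), k g⟫_ℂ := fun f g => rfl
  have hBω : ∀ f g, B f g + ψ f * ψ g = ω.eval (Ω.field f * Ω.field g) := by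
    intro f g
    have h := hW (star f) g
    rw [hψ, Complex.conj_conj] at h
    rw [hBk, ← h]
    simp [twoPointForm, Ω.star_field]
  -- The removed part `ψ f * ψ g` is symmetric, so `B` still carries the full commutator and defines
  -- a representation of the same algebra.
  have hB : ∀ f g, B f g - B g f = -I * Ω.form f g := by
    intro f g
    have h := congrArg ω.eval (Ω.field_commutator f g)
    rw [Algebra.algebraMap_eq_smul_one, map_smul, ω.eval_one, map_sub, ← hBω, ← hBω,
      smul_eq_mul] at h
    linear_combination h
  let b := Module.Basis.ofVectorSpace ℂ V
  let part : ℝ → FieldState Ω := fun c =>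
    { eval := FockModel.functional b B ψ hB (HalfGaussian.expectation c)
      eval_one := by
        have h := FockModel.functional_word b B ψ hB (HalfGaussian.expectation c) []
        simp only [CommutatorForm.word, List.map_nil, List.prod_nil] at h
        rw [h]
        simp [FockModel.correlator, HalfGaussian.expectation_one]
      -- Positivity holds at each fixed value of the classical variable and survives integration
      -- against a positive weight.
      nonneg := fun a => HalfGaussian.expectation_nonneg c _ fun x =>
        FockModel.functional_eval_nonneg b B ψ hB k hBk hψ x a }
  have hcorr : FockModel.correlator b B ψ HalfGaussian.symmetricExpectation = ω.correlator := by
    funext l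
    have h1 := FockModel.isWick_correlator_gaussian b B ψ HalfGaussian.symmetricExpectation
      HalfGaussian.symmetricExpectation_one HalfGaussian.symmetricExpectation_X_mul
    exact h1.eq_of_eqOn hω.isWick Set.univ (fun f _ g _ => hBω f g) l fun _ _ => trivial
  have hsym : FockModel.functional b B ψ hB HalfGaussian.symmetricExpectation = ω.eval := by
    refine LinearMap.ext_on_range CommutatorForm.span_word fun l => ?_
    rw [FockModel.functional_word, hcorr]
    rfl
  intro hpure
  obtain ⟨h1, -⟩ := hpure (part 1) (part (-1)) (1 / 2) (by norm_num) (by norm_num) fun a => by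
    rw [← hsym, FockModel.functional_apply, HalfGaussian.symmetricExpectation,
      LinearMap.smul_apply, LinearMap.add_apply, smul_eq_mul]
    change _ = _ * FockModel.functional b B ψ hB (HalfGaussian.expectation 1) a +
      _ * FockModel.functional b B ψ hB (HalfGaussian.expectation (-1)) a
    rw [FockModel.functional_apply, FockModel.functional_apply]
    push_cast
    ring
  -- If the component with `x > 0` equalled `ω`, its one-point function `ψ f` times the nonzero
  -- half-line mean would vanish for every `f`.
  refine hψ0 (LinearMap.ext fun f => ?_)
  have h2 := h1 (Ω.field f)
  rw [hω.1 f] at h2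
  change FockModel.functional b B ψ hB (HalfGaussian.expectation 1) (Ω.field f) = 0 at h2
  rw [FockModel.functional_apply, FockModel.rep_field, FockModel.vacuumEval_fieldOp,
    Derivation.map_one_eq_zero, map_zero, zero_add, map_smul, map_one, mul_one, smul_eq_mul] at h2
  exact (mul_eq_zero.mp h2).resolve_right HalfGaussian.expectation_one_X_ne_zero

/-- For a pure zero-mean Gaussian state, `R² = -1`. -/
theorem IsPure.R_mul_R {ω : FieldState Ω} (hpure : ω.IsPure) (hω : ω.IsZeroMeanGaussian) :
    ω.R * ω.R = -1 := by
  by_contra hne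
  set N : ω.K →L[ℂ] ω.K := 1 + ω.R * ω.R with hN
  have hN0 : N ≠ 0 := fun h => hne (by rw [eq_neg_iff_add_eq_zero, add_comm]; exact h)
  -- a real test function on which `1 + R²` does not vanish
  obtain ⟨w, hw, hwN⟩ : ∃ w : V, star w = w ∧ N (ω.ket w) ≠ 0 := by
    by_contra! hcon
    refine hN0 (ω.operator_ext fun f g => ?_)
    -- Both `g + star g` and `i (g - star g)` are real, and together they determine `g`.
    have h1 := hcon (g + star g) (by rw [star_add, star_star, add_comm])
    have h2 := hcon (I • (g - star g)) (by
      rw [star_smul, star_sub, star_star, ← starRingEnd_apply, Complex.conj_I, neg_smul,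
        ← smul_neg, neg_sub])
    rw [map_smul, map_smul, smul_eq_zero_iff_right I_ne_zero, map_sub, map_sub, sub_eq_zero] at h2
    rw [map_add, map_add, ← h2, ← two_smul ℂ, smul_eq_zero_iff_right two_ne_zero] at h1
    rw [h1, _root_.zero_apply]
  set Y := 1 - I • ω.R with hY
  set Y' := 1 + I • ω.R with hY'
  have hYX : Y = X (MuDominated.refl ω) := by rw [X_eq, Q_refl]
  have hY0 : 0 ≤ Y := hYX ▸ X_nonneg _
  have hYs : star Y = Y := hY0.isSelfAdjoint.star_eq
  have hYY' : Y * Y' = N := by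
    rw [hY, hY', hN, sub_mul, mul_add, mul_add, smul_mul_smul_comm, I_mul_I]
    simp only [mul_one, one_mul, neg_smul, one_smul]
    abel
  set S := CFC.sqrt Y with hS
  have hsqrt : ∀ {T : ω.K →L[ℂ] ω.K}, 0 ≤ T → ∀ x y : ω.K,
      ⟪CFC.sqrt T x, CFC.sqrt T y⟫_ℂ = ⟪x, T y⟫_ℂ := fun {T} hT x y => by
    have hs : IsSelfAdjoint (CFC.sqrt T) := (CFC.sqrt_nonneg T).isSelfAdjoint
    conv_rhs => rw [← CFC.sqrt_mul_sqrt_self T hT, mul_apply_eq_comp,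
      ← ContinuousLinearMap.adjoint_inner_left, ← ContinuousLinearMap.star_eq_adjoint, hs.star_eq]
  set c : ℝ := ‖S (Y' (ω.ket w))‖ with hc
  have hc0 : 0 ≤ c := norm_nonneg _
  set ε : ℝ := (1 + c)⁻¹ with hε
  have hε0 : 0 < ε := by positivity
  have hεc : ε * c ≤ 1 := by
    rw [hε, inv_mul_le_iff₀ (by positivity)]
    linarith
  -- `N` serves two purposes: it factors through `Y`, which gives the bound by `√Y`, and it is a
  -- real operator, so `u` is fixed by conjugation. `Y` alone would not preserve real vectors. The
  -- factor `ε` normalizes the bound to constant `1`.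
  set u : ω.K := (ε : ℂ) • N (ω.ket w) with hu
  have hu0 : u ≠ 0 := smul_ne_zero (Complex.ofReal_ne_zero.mpr hε0.ne') hwN
  have hbound : ∀ x, ‖⟪u, x⟫_ℂ‖ ≤ ‖S x‖ := by
    intro x
    have h1 : ⟪N (ω.ket w), x⟫_ℂ = ⟪S (Y' (ω.ket w)), S x⟫_ℂ := by
      rw [hsqrt hY0, ← hYY', mul_apply_eq_comp, ← ContinuousLinearMap.adjoint_inner_right,
        ← ContinuousLinearMap.star_eq_adjoint, hYs]
    rw [hu, inner_smul_left, norm_mul, RCLike.norm_conj, Complex.norm_real, Real.norm_eq_abs,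
      abs_of_pos hε0, h1]
    calc ε * ‖⟪S (Y' (ω.ket w)), S x⟫_ℂ‖ ≤ ε * (c * ‖S x‖) := by
          gcongr
          exact norm_inner_le_norm _ _
      _ = (ε * c) * ‖S x‖ := by ring
      _ ≤ 1 * ‖S x‖ := by gcongr
      _ = ‖S x‖ := one_mul _
  -- Subtracting the rank-one operator `|u⟩⟨u|` keeps the form nonnegative by `hbound`; `√T`
  -- supplies the remaining covariance.
  set T : ω.K →L[ℂ] ω.K := Y - (innerSL ℂ u).smulRight u with hT
  have hTin : ∀ x y, ⟪x, T y⟫_ℂ = ⟪x, Y y⟫_ℂ - ⟪x, u⟫_ℂ * ⟪u, y⟫_ℂ := by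
    intro x y
    rw [hT, _root_.sub_apply, inner_sub_right, ContinuousLinearMap.smulRight_apply,
      inner_smul_right, mul_comm, innerSL_apply_apply]
  have hT0 : 0 ≤ T := by
    refine ω.operator_nonneg fun f => ?_
    have h1 := hbound (ω.ket f)
    have h2 : ⟪ω.ket f, T (ω.ket f)⟫_ℂ =
        ((‖S (ω.ket f)‖ ^ 2 - ‖⟪u, ω.ket f⟫_ℂ‖ ^ 2 : ℝ) : ℂ) := by
      rw [hTin, ← hsqrt hY0, inner_self_eq_norm_sq_to_K, ← inner_conj_symm (ω.ket f) u,
        ← Complex.normSq_eq_conj_mul_self, Complex.normSq_eq_norm_sq]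
      push_cast
      rfl
    rw [h2]
    refine Complex.zero_le_real.mpr (sub_nonneg.mpr ?_)
    gcongr
  have hconj : ω.conjugation u = u := by
    have hNc : ω.conjugation (N (ω.ket w)) = N (ω.ket w) := by
      rw [hN]
      simp only [_root_.add_apply, mul_apply_eq_comp, one_apply_eq_self, map_add,
        ← R_conjugation, conjugation_ket, hw]
    rw [hu, ContinuousLinearMap.map_smulₛₗ, hNc, Complex.conj_ofReal]
  refine hω.not_isPure (((CFC.sqrt T : ω.K →L[ℂ] ω.K) : ω.K →ₗ[ℂ] ω.K) ∘ₗ ω.ket) (innerₛₗ ℂ u ∘ₗ ω.ket)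
    (fun f => ?_) (fun h0 => hu0 ?_) (fun f g => ?_) hpure
  · change ⟪u, ω.ket (star f)⟫_ℂ = (starRingEnd ℂ) ⟪u, ω.ket f⟫_ℂ
    rw [← conjugation_ket, inner_conj_symm]
    conv_lhs => rw [← hconj, inner_conjugation]
  · refine ω.denseRange_ket.eq_of_inner_left ℂ fun f => ?_
    rw [inner_zero_left]
    exact LinearMap.congr_fun h0 f
  · change _ = ⟪CFC.sqrt T (ω.ket f), CFC.sqrt T (ω.ket g)⟫_ℂ +
      (starRingEnd ℂ) ⟪u, ω.ket f⟫_ℂ * ⟪u, ω.ket g⟫_ℂ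
    rw [hsqrt hT0, hTin, hYX, inner_X, inner_conj_symm]
    ring

end FieldState

end Decomposition

/-! ### Eigenspaces of a skew-adjoint operator with square `-1` -/

section Eigenspaces

variable {H : Type*} [NormedAddCommGroup H] [InnerProductSpace ℂ H] [CompleteSpace H]
  {R : H →L[ℂ] H}

theorem mem_eigenspaceOf {T : H →L[ℂ] H} {z : ℂ} {x : H} : x ∈ eigenspaceOf T z ↔ T x = z • x := by
  change T x - z • x = 0 ↔ _
  rw [sub_eq_zero]

/-- The spectral projection of a skew-adjoint operator with square `-1`. -/
noncomputable def complexProjection (R : H →L[ℂ] H) : H →L[ℂ] H := (1 / 2 : ℂ) • (1 - I • R)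

theorem complexProjection_add_self : complexProjection R + complexProjection R = 1 - I • R := by
  rw [complexProjection, ← add_smul]
  norm_num

theorem complexProjection_apply (x : H) :
    complexProjection R x = (1 / 2 : ℂ) • (x - I • R x) := rfl

theorem star_complexProjection (hR : star R = -R) :
    star (complexProjection R) = complexProjection R := by
  rw [complexProjection, star_smul, star_sub, star_one, star_smul, hR]
  congr 1
  · rw [show (1 / 2 : ℂ) = ((1 / 2 : ℝ) : ℂ) by norm_num]
    exact Complex.conj_ofReal _
  · rw [← starRingEnd_apply, Complex.conj_I, neg_smul_neg]

theorem complexProjection_mul_self (hR2 : R * R = -1) :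
    complexProjection R * complexProjection R = complexProjection R := by
  have h : (1 - I • R) * (1 - I • R) = (2 : ℂ) • (1 - I • R) := by
    simp only [sub_mul, mul_sub, one_mul, mul_one, smul_mul_smul_comm, I_mul_I, hR2, neg_smul_neg,
      one_smul, two_smul]
    abel
  rw [complexProjection, smul_mul_smul_comm, h, smul_smul]
  norm_num

theorem complexProjection_mem (hR2 : R * R = -1) (x : H) :
    complexProjection R x ∈ eigenspaceOf R I := by
  have h2 : R (R x) = -x := by rw [← mul_apply_eq_comp, hR2]; rfl
  rw [mem_eigenspaceOf, complexProjection_apply, map_smul, map_sub, map_smul, h2, smul_comm I,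
    smul_sub I, smul_smul, I_mul_I]
  congr 1
  rw [smul_neg, neg_smul, one_smul]
  abel

theorem sub_complexProjection_mem (hR2 : R * R = -1) (x : H) :
    x - complexProjection R x ∈ eigenspaceOf R (-I) := by
  have h2 : R (R x) = -x := by rw [← mul_apply_eq_comp, hR2]; rfl
  have h3 : x - complexProjection R x = (1 / 2 : ℂ) • (x + I • R x) := by
    rw [complexProjection_apply]
    module
  rw [mem_eigenspaceOf, h3, map_smul, map_add, map_smul, h2, smul_comm (-I), smul_add (-I),
    smul_smul, neg_mul, I_mul_I]
  congr 1
  module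

theorem inner_eq_zero_of_mem_eigenspaceOf (hR : star R = -R) {x y : H}
    (hx : x ∈ eigenspaceOf R I) (hy : y ∈ eigenspaceOf R (-I)) : ⟪x, y⟫_ℂ = 0 := by
  rw [mem_eigenspaceOf] at hx hy
  have h : ⟪x, R y⟫_ℂ = ⟪star R x, y⟫_ℂ := by
    rw [ContinuousLinearMap.star_eq_adjoint, ContinuousLinearMap.adjoint_inner_left]
  rw [hR, hy, _root_.neg_apply, hx, inner_smul_right, inner_neg_left, inner_smul_left,
    Complex.conj_I] at h
  have h2 : (2 * I) * ⟪x, y⟫_ℂ = 0 := by linear_combination -h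
  exact (mul_eq_zero.mp h2).resolve_left (mul_ne_zero two_ne_zero I_ne_zero)

theorem eigenspaceOf_orthogonal (hR : star R = -R) (hR2 : R * R = -1) :
    (eigenspaceOf R I)ᗮ = eigenspaceOf R (-I) := by
  ext x
  refine ⟨fun hx => ?_, fun hx => ?_⟩
  · have h1 := complexProjection_mem hR2 x
    have h2 := sub_complexProjection_mem hR2 x
    have h3 : ⟪complexProjection R x, complexProjection R x⟫_ℂ = 0 := by
      have h4 := (Submodule.mem_orthogonal _ _).mp hx _ h1
      rw [← sub_add_cancel x (complexProjection R x), inner_add_right,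
        sub_add_cancel, inner_eq_zero_of_mem_eigenspaceOf hR h1 h2, zero_add] at h4
      exact h4
    rw [inner_self_eq_zero.mp h3, sub_zero] at h2
    exact h2
  · exact (Submodule.mem_orthogonal _ _).mpr fun y hy =>
      inner_eq_zero_of_mem_eigenspaceOf hR hy hx

theorem starProjection_eigenspaceOf_I (hR : star R = -R) (hR2 : R * R = -1) :
    (eigenspaceOf R I).starProjection = complexProjection R := by
  ext x
  refine Submodule.eq_starProjection_of_mem_orthogonal (complexProjection_mem hR2 x) ?_
  rw [eigenspaceOf_orthogonal hR hR2]
  exact sub_complexProjection_mem hR2 x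

theorem starProjection_eigenspaceOf_neg_I (hR : star R = -R) (hR2 : R * R = -1) :
    (eigenspaceOf R (-I)).starProjection = 1 - complexProjection R := by
  ext x
  refine Submodule.eq_starProjection_of_mem_orthogonal (sub_complexProjection_mem hR2 x) ?_
  change x - (x - complexProjection R x) ∈ _
  rw [sub_sub_cancel]
  exact (Submodule.mem_orthogonal' _ _).mpr fun y hy =>
    inner_eq_zero_of_mem_eigenspaceOf hR (complexProjection_mem hR2 x) hy

/-- A nonzero vector has a nonzero component in at least one eigenspace. The antilinear `G` commutes
with `R`, so it conjugates eigenvalues and supplies an eigenvector for the other one. -/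
theorem hasEigenvalue_iff_of_conj [Nontrivial H] (hR2 : R * R = -1) (G : H →ₗ⋆[ℂ] H)
    (hG : ∀ x, G (G x) = x) (hGR : ∀ x, R (G x) = G (R x)) (z : ℂ) :
    Module.End.HasEigenvalue (R : Module.End ℂ H) z ↔ z = I ∨ z = -I := by
  have hR2x : ∀ x, R (R x) = -x := fun x => by rw [← mul_apply_eq_comp, hR2]; rfl
  have key : ∀ {y : ℂ} {x : H}, x ≠ 0 → R x = y • x →
      Module.End.HasEigenvalue (R : Module.End ℂ H) y := fun hx h =>
    Module.End.hasEigenvalue_of_hasEigenvector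
      (Module.End.hasEigenvector_iff.mpr ⟨Module.End.mem_eigenspace_iff.mpr h, hx⟩)
  have hGne : ∀ {x : H}, x ≠ 0 → G x ≠ 0 := fun {x} hx h => hx (by rw [← hG x, h, map_zero])
  have hGeig : ∀ {y : ℂ} {x : H}, R x = y • x → R (G x) = (starRingEnd ℂ) y • G x :=
    fun {y x} h => by rw [hGR, h, LinearMap.map_smulₛₗ]
  refine ⟨fun h => ?_, fun h => ?_⟩
  · obtain ⟨x, hx⟩ := h.exists_hasEigenvector
    have h1 : R x = z • x := hx.apply_eq_smul
    have h2 := hR2x x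
    rw [h1, map_smul, h1, smul_smul, ← neg_one_smul ℂ x] at h2
    have h3 : z * z = -1 := smul_left_injective ℂ hx.2 h2
    have h4 : (z - I) * (z + I) = 0 := by linear_combination h3 - I_mul_I
    rcases mul_eq_zero.mp h4 with h5 | h5
    · exact Or.inl (sub_eq_zero.mp h5)
    · exact Or.inr (eq_neg_of_add_eq_zero_left h5)
  · obtain ⟨x, hx, hxe⟩ : ∃ x : H, x ≠ 0 ∧ (R x = I • x ∨ R x = -I • x) := by
      obtain ⟨x, hx⟩ := exists_ne (0 : H)
      by_cases h0 : complexProjection R x = 0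
      · refine ⟨x, hx, Or.inr ?_⟩
        have := sub_complexProjection_mem hR2 x
        rwa [h0, sub_zero, mem_eigenspaceOf] at this
      · exact ⟨_, h0, Or.inl (mem_eigenspaceOf.mp (complexProjection_mem hR2 x))⟩
    rcases hxe with hxe | hxe <;> have hxe' := hGeig hxe <;> rcases h with rfl | rfl
    · exact key hx hxe
    · exact key (hGne hx) (by rwa [Complex.conj_I] at hxe')
    · exact key (hGne hx) (by rwa [map_neg, Complex.conj_I, neg_neg] at hxe')
    · exact key hx hxe

end Eigenspaces

/-! ### The main theorem -/

theorem mainTheorem9 {V : Type*} [AddCommGroup V] [Module ℂ V] [StarAddMonoid V] [StarModule ℂ V]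
    (Ω : CommutatorForm V) (ω₁ ω₂ : FieldState Ω)
    (hω₁ : ω₁.IsZeroMeanGaussian) (hω₂ : ω₂.IsZeroMeanGaussian)
    (hpure : ω₁.IsPure) (hμ : FieldState.MuDominated ω₂ ω₁) :
    -- the only eigenvalues of `R₁` are `±i`, and `K_{μ₁}` is the orthogonal sum of the eigenspaces
    ((eigenspaceOf ω₁.R I)ᗮ = eigenspaceOf ω₁.R (-I) ∧
      (Nontrivial ω₁.K → ∀ z : ℂ,
        Module.End.HasEigenvalue (ω₁.R : Module.End ℂ ω₁.K) z ↔ z = I ∨ z = -I)) ∧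
    -- `√X₂ - √X₁` is Hilbert–Schmidt iff both diagonal blocks of `X₂ - X₁` are trace class
    (IsHilbertSchmidt (CFC.sqrt (FieldState.X hμ) -
        CFC.sqrt (FieldState.X (FieldState.MuDominated.refl ω₁))) ↔
      IsTraceClass (diagonalBlock
        (FieldState.X hμ - FieldState.X (FieldState.MuDominated.refl ω₁))
        (eigenspaceOf ω₁.R I)) ∧
      IsTraceClass (diagonalBlock
        (FieldState.X hμ - FieldState.X (FieldState.MuDominated.refl ω₁))
        (eigenspaceOf ω₁.R (-I)))) ∧
    -- `Q` is invertible, and the condition is also equivalent to `Q - 1` being Hilbert–Schmidt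
    -- together with `Q + R₁ Q⁻¹ R₁` being trace class
    IsUnit (FieldState.Q hμ) ∧
    (IsHilbertSchmidt (CFC.sqrt (FieldState.X hμ) -
        CFC.sqrt (FieldState.X (FieldState.MuDominated.refl ω₁))) ↔
      IsHilbertSchmidt (FieldState.Q hμ - 1) ∧
      IsTraceClass (FieldState.Q hμ + ω₁.R * Ring.inverse (FieldState.Q hμ) * ω₁.R)) := by
  have hR := ω₁.star_R
  have hR2 := hpure.R_mul_R hω₁
  set R := ω₁.R with hRdef
  set Q := FieldState.Q hμ with hQ
  set P := complexProjection R with hPdef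
  have hPs : star P = P := star_complexProjection hR
  have hP : P * P = P := complexProjection_mul_self hR2
  have hPP : P + P = 1 - I • R := complexProjection_add_self
  have hX₁ : FieldState.X (FieldState.MuDominated.refl ω₁) = P + P := by
    rw [FieldState.X_eq, FieldState.Q_refl, hPP]
  have hX₂ : FieldState.X hμ = Q - 1 + (P + P) := by
    rw [FieldState.X_eq, hPP]
    abel
  have hX : 0 ≤ Q - 1 + (P + P) := hX₂ ▸ FieldState.X_nonneg hμ
  have hX' : 0 ≤ Q - 1 + ((1 - P) + (1 - P)) := by
    have h : Q - 1 + ((1 - P) + (1 - P)) = Q + I • R := by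
      rw [show Q - 1 + ((1 - P) + (1 - P)) = Q + 1 - (P + P) by abel, hPP]
      abel
    rw [h]
    exact FieldState.Q_add_nonneg hμ
  let G : ω₁.K →ₗ⋆[ℂ] ω₁.K := ω₁.conjugation.toLinearMap
  have hG : ∀ x, G (G x) = x := ω₁.conjugation_conjugation
  have hGR : ∀ x, R (G x) = G (R x) := ω₁.R_conjugation
  -- `G` commutes with `R` but is antilinear, so it turns `1 - i R` into `1 + i R` and exchanges the
  -- two spectral projections.
  have hGP : ∀ x, P (G x) = G (x - P x) := by
    intro x
    have h : x - P x = (1 / 2 : ℂ) • (x + I • R x) := by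
      rw [hPdef, complexProjection_apply]
      module
    have h2 : (starRingEnd ℂ) (1 / 2 : ℂ) = 1 / 2 := by
      rw [show (1 / 2 : ℂ) = ((1 / 2 : ℝ) : ℂ) by norm_num]
      exact Complex.conj_ofReal _
    rw [h, hPdef, complexProjection_apply, hGR, LinearMap.map_smulₛₗ, map_add,
      LinearMap.map_smulₛₗ, Complex.conj_I, h2, neg_smul, sub_eq_add_neg]
  have hunit : IsUnit Q := by
    have hA : (P + P - 1) * (P + P - 1) = 1 := by
      rw [sub_mul, mul_sub, add_mul, mul_add, hP]
      noncomm_ring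
    refine isUnit_of_dominates hA (by rw [star_sub, star_add, star_one, hPs]) ?_ ?_
    · convert hX using 1
      abel
    · convert hX' using 1
      abel
  have hsqrt := isHilbertSchmidt_sqrt_sub_sqrt_iff hP hPs hX hX' G hG ω₁.inner_conjugation hGP
    (FieldState.Q_conjugation hμ)
  have hblocks := isTraceClass_compressions_iff hP hPs hX hX' (Ring.inverse_mul_cancel Q hunit)
    (Ring.mul_inverse_cancel Q hunit)
  have hB := compression_nonneg hP hPs hX'
  have hB' := compression_nonneg (P := 1 - P) (Q := Q) (IsIdempotentElem.one_sub hP)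
    (by rw [star_sub, star_one, hPs]) (by rwa [sub_sub_cancel])
  -- `P + P - 1 = -i R`, and the two factors `-i` multiply to `-1`; this accounts for the plus sign
  -- in `Q + R Q⁻¹ R`.
  have hAVA : Q - (P + P - 1) * Ring.inverse Q * (P + P - 1) = Q + R * Ring.inverse Q * R := by
    have h : P + P - 1 = -(I • R) := by
      rw [hPP]
      abel
    rw [h, neg_mul, neg_mul, mul_neg, neg_neg, smul_mul_assoc, smul_mul_smul_comm, I_mul_I,
      neg_one_smul, sub_neg_eq_add]
  rw [hAVA] at hblocks
  have hdiag := starProjection_eigenspaceOf_I hR hR2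
  have hdiag' := starProjection_eigenspaceOf_neg_I hR hR2
  rw [hX₂, hX₁, add_sub_cancel_right]
  refine ⟨⟨eigenspaceOf_orthogonal hR hR2, fun _ =>
    hasEigenvalue_iff_of_conj hR2 G hG hGR⟩, ?_, hunit, hsqrt.trans hblocks⟩
  rw [isTraceClass_diagonalBlock_iff _ _ (by rw [hdiag]; exact hB),
    isTraceClass_diagonalBlock_iff _ _ (by rw [hdiag']; exact hB'), hdiag, hdiag']
  exact hsqrt
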